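/- Let $\mathbb{H}^n=\mathbb{R}^n\times\mathbb{R}^n\times\mathbb{R}$ be the Heisenberg group with multiplication $(x,y,t)(x',y',t')=(x+x',y+y',t+t'+x\cdot y')$, and write points of the dual vector space as $\zeta=(w,\lambda)$, $w\in\mathbb{R}^{2n}$, $\lambda\in\mathbb{R}$. A tempered distribution $K$ on $\mathbb{H}^n$ is a *flag kernel* if its Euclidean Fourier transform (with $\widehat f(\zeta)=\int f(h)e^{-2\pi i h\cdot\zeta}\,dh$) is a function $\widehat K$ which is smooth on $\{\lambda\neq0\}$ and satisfies there, for all multi-indices $\alpha$ and all $\beta\in\mathbb{N}$, $|\partial_w^\alpha\partial_\lambda^\beta\widehat K(w,\lambda)|\le c_{\alpha,\beta}(\|w\|+|\lambda|^{1/2})^{-|\alpha|}|\lambda|^{-\beta}$ (so that $\widehat K\in L^\infty$). It is *symmetric* if $K=K^\star$, where $\langle K^\star,f\rangle=\overline{\langle K,f^\star\rangle}$ and $f^\star(h)=\overline{f(h^{-1})}$ for Schwartz functions $f$. $\mathrm{Op}(K)$ is the bounded operator on $L^2(\mathbb{H}^n)$ given on Schwartz functions by $\mathrm{Op}(K)f=K\star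 f$, $K\star f(h)=\int K(h')f(h'^{-1}h)\,dh'$ (in the sense of distributions). For $\lambda\ne0$ let $\pi^\lambda_{(x,y,t)}f(s)=e^{2\pi i\lambda t}e^{2\pi i\sqrt{|\lambda|}\,y\cdot s}f(s+\mathrm{sgn}(\lambda)\sqrt{|\lambda|}\,x)$ be the Schrödinger representation on $L^2(\mathbb{R}^n)$, and for $f,g\in\mathcal{S}(\mathbb{R}^n)$ put $C^\lambda_{f,g}(h)=\int_{\mathbb{R}^n}\pi^\lambda_hf(s)\,g(s)\,ds$. The pairing with a flag kernel $K$ extends to functions $F(h)=\int e^{2\pi i h\cdot\zeta}\,d\mu(\zeta)$, where $\mu$ is a bounded complex measure vanishing on $\{|\lambda|<\varepsilon\}$ for some $\varepsilon>0$, by $\langle K,F\rangle=\int\widehat K(-\zeta)\,d\mu(\zeta)$. The functions $C^\lambda_{f,g}$ are of this form, and $\pi^\lambda_K$ is the operator on $L^2(\mathbb{R}^n)$ defined weakly by $\int(\pi^\lambda_Kf)\,g\,ds=\langle K,C^\lambda_{f,g}\rangle$ for $f,g\in\mathcal{S}(\mathbb{R}^n)$. **Theorem.** Let $K$ be a symmetric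 flag kernel such that $\mathrm{Op}(K)$ is invertible on $L^2(\mathbb{H}^n)$. Then for every $\lambda\neq0$ the operator $\pi_K^\lambda$ is bounded and invertible on $L^2(\mathbb{R}^n)$, and there is a constant $C$ such that $\|(\pi_K^\lambda)^{-1}\|\le C$ for all $\lambda\neq0$. -/

import Mathlib

open MeasureTheory FourierTransform SchwartzMap
open scoped ContDiff ComplexConjugate

noncomputable section

namespace FlagKernel

/-- Euclidean space `ℝⁿ`. -/
abbrev Rn (n : ℕ) := EuclideanSpace ℝ (Fin n)

/-- The underlying space `ℝⁿ × ℝⁿ × ℝ` of the Heisenberg group, with coordinates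
`h = (x, y, t) = (v, t)`: `x i = h (inl (inl i))`, `y i = h (inl (inr i))`, `t = h (inr ())`,
and `v j = h (inl j)`. The dual space `ζ = (ξ, η, λ) = (w, λ)` is identified with it through the
dot product `h ζ = x ξ + y η + t λ`, which is the inner product. -/
abbrev Heis (n : ℕ) := EuclideanSpace ℝ ((Fin n ⊕ Fin n) ⊕ Unit)

variable {n : ℕ}

/-- The component `x` of `(x, y, t)`. -/
def xc (h : Heis n) : Rn n := WithLp.toLp 2 fun i => h (Sum.inl (Sum.inl i))

/-- The component `y` of `(x, y, t)`. -/
def yc (h : Heis n) : Rn n := WithLp.toLp 2 fun i => h (Sum.inl (Sum.inr i))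

/-- The central component `t` of `(x, y, t)`. -/
def tc (h : Heis n) : ℝ := h (Sum.inr ())

/-- The point `(x, y, t)`. -/
def mk (x y : Rn n) (t : ℝ) : Heis n :=
  WithLp.toLp 2 (Sum.elim (Sum.elim x y) fun _ => t)

/-- The group law `(x, y, t) (x', y', t') = (x + x', y + y', t + t' + x y')`. -/
def mul (h k : Heis n) : Heis n :=
  mk (xc h + xc k) (yc h + yc k) (tc h + tc k + inner ℝ (xc h) (yc k))

/-- The group inverse `(x, y, t)⁻¹ = (-x, -y, -t + x y)`. -/
def inv (h : Heis n) : Heis n :=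
  mk (-xc h) (-yc h) (-tc h + inner ℝ (xc h) (yc h))

theorem ext_coord {h k : Heis n} (hx : xc h = xc k) (hy : yc h = yc k) (ht : tc h = tc k) :
    h = k := by
  ext j
  rcases j with (i | i) | u
  · exact congrArg (fun v : Rn n => v i) hx
  · exact congrArg (fun v : Rn n => v i) hy
  · exact ht

@[simp] theorem xc_mk (x y : Rn n) (t : ℝ) : xc (mk x y t) = x := rfl
@[simp] theorem yc_mk (x y : Rn n) (t : ℝ) : yc (mk x y t) = y := rfl
@[simp] theorem tc_mk (x y : Rn n) (t : ℝ) : tc (mk x y t) = t := rfl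
@[simp] theorem xc_zero : xc (0 : Heis n) = 0 := rfl
@[simp] theorem yc_zero : yc (0 : Heis n) = 0 := rfl
@[simp] theorem tc_zero : tc (0 : Heis n) = 0 := rfl

/-- Associativity of the group law. -/
theorem mul_assoc' (a b c : Heis n) : mul (mul a b) c = mul a (mul b c) := by
  apply ext_coord
  · simp [mul, add_assoc]
  · simp [mul, add_assoc]
  · simp [mul, inner_add_left, inner_add_right]; ring

/-- `inv h` is the inverse of `h`; the identity element is `0`. -/
theorem inv_mul (h : Heis n) : mul (inv h) h = 0 := by
  apply ext_coord <;> simp [mul, inv]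

theorem mul_inv (h : Heis n) : mul h (inv h) = 0 := by
  apply ext_coord <;> simp [mul, inv]

theorem mul_zero' (h : Heis n) : mul h 0 = h := by
  apply ext_coord <;> simp [mul]

theorem norm_sq_eq (h : Heis n) : ‖h‖ ^ 2 = ‖xc h‖ ^ 2 + ‖yc h‖ ^ 2 + tc h ^ 2 := by
  simp [EuclideanSpace.norm_sq_eq, Fintype.sum_sum_type, xc, yc, tc]

theorem norm_xc_le (h : Heis n) : ‖xc h‖ ≤ ‖h‖ := by
  apply le_of_sq_le_sq _ (norm_nonneg h)
  rw [norm_sq_eq h]; nlinarith [sq_nonneg ‖yc h‖, sq_nonneg (tc h)]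

theorem norm_yc_le (h : Heis n) : ‖yc h‖ ≤ ‖h‖ := by
  apply le_of_sq_le_sq _ (norm_nonneg h)
  rw [norm_sq_eq h]; nlinarith [sq_nonneg ‖xc h‖, sq_nonneg (tc h)]

theorem abs_tc_le (h : Heis n) : |tc h| ≤ ‖h‖ := by
  apply le_of_sq_le_sq _ (norm_nonneg h)
  rw [norm_sq_eq h, sq_abs]; nlinarith [sq_nonneg ‖xc h‖, sq_nonneg ‖yc h‖]

theorem norm_le_sum (h : Heis n) : ‖h‖ ≤ ‖xc h‖ + ‖yc h‖ + |tc h| := by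
  apply le_of_sq_le_sq _ (by positivity)
  rw [norm_sq_eq h, ← sq_abs (tc h)]
  nlinarith [mul_nonneg (norm_nonneg (xc h)) (norm_nonneg (yc h)),
    mul_nonneg (norm_nonneg (xc h)) (abs_nonneg (tc h)),
    mul_nonneg (norm_nonneg (yc h)) (abs_nonneg (tc h))]

theorem temperate_coord (j : (Fin n ⊕ Fin n) ⊕ Unit) :
    Function.HasTemperateGrowth fun k : Heis n => k j :=
  (EuclideanSpace.proj (𝕜 := ℝ) j : Heis n →L[ℝ] ℝ).hasTemperateGrowth

theorem temperate_of_coord {F : Heis n → Heis n}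
    (hF : ∀ j, Function.HasTemperateGrowth fun k => F k j) : Function.HasTemperateGrowth F := by
  have h : F = fun k => ∑ j, (F k j) • (EuclideanSpace.single j (1 : ℝ) : Heis n) := by
    funext k
    ext i
    simp only [WithLp.ofLp_sum, WithLp.ofLp_smul, Finset.sum_apply, Pi.smul_apply, smul_eq_mul,
      PiLp.ofLp_single, Pi.single_apply, mul_ite, mul_one, mul_zero, Finset.sum_ite_eq,
      Finset.mem_univ, if_true]
  rw [h]
  exact Function.HasTemperateGrowth.sum fun j _ =>
    (hF j).smul (Function.HasTemperateGrowth.const _)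

theorem temperate_inv_mul (h : Heis n) :
    Function.HasTemperateGrowth fun k : Heis n => mul (inv k) h := by
  apply temperate_of_coord
  rintro ((i | i) | u)
  · have e : (fun k : Heis n => (mul (inv k) h) (Sum.inl (Sum.inl i))) =
        fun k => -(k (Sum.inl (Sum.inl i))) + h (Sum.inl (Sum.inl i)) := by
      funext k; simp [mul, inv, mk, xc]
    rw [e]
    exact (temperate_coord _).neg.add (Function.HasTemperateGrowth.const _)
  · have e : (fun k : Heis n => (mul (inv k) h) (Sum.inl (Sum.inr i))) =
        fun k => -(k (Sum.inl (Sum.inr i))) + h (Sum.inl (Sum.inr i)) := by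
      funext k; simp [mul, inv, mk, yc]
    rw [e]
    exact (temperate_coord _).neg.add (Function.HasTemperateGrowth.const _)
  · have e : (fun k : Heis n => (mul (inv k) h) (Sum.inr u)) =
        fun k => (-(k (Sum.inr ())) +
          ∑ i, k (Sum.inl (Sum.inl i)) * k (Sum.inl (Sum.inr i))) + h (Sum.inr ()) +
          ∑ i, (-(k (Sum.inl (Sum.inl i)))) * h (Sum.inl (Sum.inr i)) := by
      funext k
      simp [mul, inv, mk, xc, yc, tc, PiLp.inner_apply, mul_comm]
    rw [e]
    exact (((temperate_coord _).neg.add (Function.HasTemperateGrowth.sum fun i _ =>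
      (temperate_coord _).mul (temperate_coord _))).add
      (Function.HasTemperateGrowth.const _)).add (Function.HasTemperateGrowth.sum fun i _ =>
      (temperate_coord _).neg.mul (Function.HasTemperateGrowth.const _))

theorem bound_inv_mul (h : Heis n) : ∃ (k : ℕ) (C : ℝ), ∀ a : Heis n,
    ‖a‖ ≤ C * (1 + ‖mul (inv a) h‖) ^ k := by
  refine ⟨2, 3 + 3 * ‖h‖, fun a => ?_⟩
  set g := mul (inv a) h with hg
  have hx : xc a = xc h - xc g := by simp [hg, mul, inv]
  have hy : yc a = yc h - yc g := by simp [hg, mul, inv]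
  have ht : tc a = tc h - tc g + inner ℝ (xc a) (yc a - yc h) := by
    simp [hg, mul, inv, inner_sub_right, inner_neg_left]; ring
  have ht' : tc a = tc h - tc g - inner ℝ (xc h - xc g) (yc g) := by
    rw [ht, hx, hy]; simp [inner_sub_left, inner_neg_right]; ring
  have h1 : ‖xc a‖ ≤ ‖h‖ + ‖g‖ := by
    rw [hx]; exact (norm_sub_le _ _).trans (add_le_add (norm_xc_le h) (norm_xc_le g))
  have h2 : ‖yc a‖ ≤ ‖h‖ + ‖g‖ := by
    rw [hy]; exact (norm_sub_le _ _).trans (add_le_add (norm_yc_le h) (norm_yc_le g))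
  have h3 : |inner ℝ (xc h - xc g) (yc g)| ≤ (‖h‖ + ‖g‖) * ‖g‖ := by
    refine (abs_real_inner_le_norm _ _).trans ?_
    rw [hx] at h1
    exact mul_le_mul h1 (norm_yc_le g) (norm_nonneg _) (by positivity)
  have h4 : |tc a| ≤ ‖h‖ + ‖g‖ + (‖h‖ + ‖g‖) * ‖g‖ := by
    rw [ht']
    have e1 := abs_sub (tc h - tc g) (inner ℝ (xc h - xc g) (yc g))
    have e2 := abs_sub (tc h) (tc g)
    have e3 := abs_tc_le h
    have e4 := abs_tc_le g
    linarith
  have h5 := norm_le_sum a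
  nlinarith [norm_nonneg h, norm_nonneg g, mul_nonneg (norm_nonneg h) (norm_nonneg g),
    mul_nonneg (norm_nonneg h) (sq_nonneg ‖g‖), sq_nonneg ‖g‖]

/-- For a Schwartz function `f` and `h` in the group, the Schwartz function `k ↦ f (k⁻¹ h)`. -/
def reflect (h : Heis n) : 𝓢(Heis n, ℂ) →L[ℂ] 𝓢(Heis n, ℂ) :=
  SchwartzMap.compCLM ℂ (temperate_inv_mul h) (bound_inv_mul h)

@[simp] theorem reflect_apply (h : Heis n) (f : 𝓢(Heis n, ℂ)) (k : Heis n) :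
    reflect h f k = f (mul (inv k) h) := rfl

/-- The convolution `K ⋆ f (h) = ⟨K, k ↦ f (k⁻¹ h)⟩` of a tempered distribution with a Schwartz
function. -/
def convolution (K : 𝓢'(Heis n, ℂ)) (f : 𝓢(Heis n, ℂ)) (h : Heis n) : ℂ := K (reflect h f)

/-- The Schwartz function `f⋆ (h) = conj (f (h⁻¹))`. -/
def involution (f : 𝓢(Heis n, ℂ)) : 𝓢(Heis n, ℂ) :=
  SchwartzMap.postcompCLM (𝕜 := ℝ) (Complex.conjCLE : ℂ →L[ℝ] ℂ) (reflect 0 f)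

@[simp] theorem involution_apply (f : 𝓢(Heis n, ℂ)) (h : Heis n) :
    involution f h = conj (f (inv h)) := by
  simp [involution, mul_zero']

/-- `K = K⋆`, where `⟨K⋆, f⟩ = conj ⟨K, f⋆⟩` (so that for a function `K` one has
`K⋆ (h) = conj (K (h⁻¹))`). -/
def IsSymmetric (K : 𝓢'(Heis n, ℂ)) : Prop :=
  ∀ f : 𝓢(Heis n, ℂ), K f = conj (K (involution f))

/-- `m` is smooth off the hyperplane `λ = 0`, and there it satisfies
`|∂_w^α ∂_λ^β m (w, λ)| ≤ c_{α,β} (‖w‖ + |λ|^{1/2})^{-|α|} |λ|^{-β}` for all `α`, `β`, where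
`‖w‖ = ∑ |w_j|`. The derivative `∂_w^α`, `|α| = a`, is written as
`∂_{w_{j_1}} ⋯ ∂_{w_{j_a}}`. -/
structure IsFlagMultiplier (m : Heis n → ℂ) : Prop where
  smooth : ContDiffOn ℝ ∞ m {ζ | tc ζ ≠ 0}
  estimate : ∀ (a b : ℕ) (j : Fin a → Fin n ⊕ Fin n), ∃ c : ℝ, ∀ ζ : Heis n, tc ζ ≠ 0 →
    ‖iteratedFDeriv ℝ (a + b) m ζ (Fin.append
        (fun i => EuclideanSpace.single (Sum.inl (j i)) (1 : ℝ))
        (fun _ => EuclideanSpace.single (Sum.inr ()) (1 : ℝ)))‖ ≤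
      c / (((∑ i, |ζ (Sum.inl i)|) + √|tc ζ|) ^ a * |tc ζ| ^ b)

/-- The Fourier transform of the tempered distribution `K` is the (bounded) function `m`, which
satisfies the flag estimates. -/
def HasFlagMultiplier (K : 𝓢'(Heis n, ℂ)) (m : Heis n → ℂ) : Prop :=
  IsFlagMultiplier m ∧ ∀ φ : 𝓢(Heis n, ℂ), (𝓕 K) φ = ∫ ζ, m ζ * φ ζ

/-- Flag kernels on the Heisenberg group. -/
def IsFlagKernel (K : 𝓢'(Heis n, ℂ)) : Prop := ∃ m, HasFlagMultiplier K m

/-- The Hilbert space `L²(ℍⁿ)` (for Lebesgue measure, which is the Haar measure). -/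
abbrev L2Heis (n : ℕ) := Lp ℂ 2 (volume : Measure (Heis n))

/-- The Hilbert space `L²(ℝⁿ)`. -/
abbrev L2Rn (n : ℕ) := Lp ℂ 2 (volume : Measure (Rn n))

/-- `A = Op(K)`: the bounded operator on `L²(ℍⁿ)` with `A f = K ⋆ f` for all Schwartz `f`. Such an
`A` is unique, since Schwartz functions are dense. -/
def IsOp (K : 𝓢'(Heis n, ℂ)) (A : L2Heis n →L[ℂ] L2Heis n) : Prop :=
  ∀ f : 𝓢(Heis n, ℂ), (A (f.toLp 2 volume) : Heis n → ℂ) =ᵐ[volume] convolution K f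

/-- The Schrödinger representation
`π_h^λ f (s) = e^{2πiλt} e^{2πi√|λ| y s} f (s + sgn(λ) √|λ| x)`, `h = (x, y, t)`, `λ ≠ 0`. -/
def schrodinger (lam : ℝ) (h : Heis n) (f : Rn n → ℂ) (s : Rn n) : ℂ :=
  Complex.exp (2 * Real.pi * Complex.I * (lam * tc h : ℝ)) *
    Complex.exp (2 * Real.pi * Complex.I * (√|lam| * inner ℝ (yc h) s : ℝ)) *
    f (s + (Real.sign lam * √|lam|) • xc h)

/-- The coefficient `C_{f,g}^λ (h) = ∫ (π_h^λ f)(s) g(s) ds`. -/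
def coefficient (lam : ℝ) (f g : Rn n → ℂ) (h : Heis n) : ℂ :=
  ∫ s, schrodinger lam h f s * g s

/-- The extended pairing `⟨K, F⟩ = z` of a flag kernel `K` with a function `F` whose Fourier
transform is a bounded complex measure `μ` with `λ`-support away from `0`, that is
`F h = ∫ e^{2πi h ζ} dμ(ζ)` and `|μ| {|λ| < ε} = 0` for some `ε > 0`. It is given by
`⟨K, F⟩ = ∫ K̂ (-ζ) dμ(ζ)`; when `F` is a Schwartz function this is `K F`. The complex measure is
written as `dμ = ρ dν` with `ν` a finite positive measure and `ρ` in `L¹(ν)`. Off `λ = 0` the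
function `K̂` is determined by continuity, and `μ` is determined by `F`, so `z` is unique. -/
def HasPairing (K : 𝓢'(Heis n, ℂ)) (F : Heis n → ℂ) (z : ℂ) : Prop :=
  ∃ m : Heis n → ℂ, HasFlagMultiplier K m ∧
  ∃ (ν : Measure (Heis n)) (ρ : Heis n → ℂ), IsFiniteMeasure ν ∧ Integrable ρ ν ∧
    (∃ ε > 0, ν {ζ | |tc ζ| < ε} = 0) ∧
    (∀ h, F h = ∫ ζ, Complex.exp (2 * Real.pi * Complex.I * (inner ℝ h ζ : ℝ)) * ρ ζ ∂ν) ∧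
    z = ∫ ζ, m (-ζ) * ρ ζ ∂ν

/-- `B = π_K^λ`: the bounded operator on `L²(ℝⁿ)` weakly defined by
`∫ (B f)(s) g(s) ds = ⟨K, C_{f,g}^λ⟩` for Schwartz `f`, `g`. Such a `B` is unique. -/
def IsRepresentationOperator (K : 𝓢'(Heis n, ℂ)) (lam : ℝ) (B : L2Rn n →L[ℂ] L2Rn n) : Prop :=
  ∀ f g : 𝓢(Rn n, ℂ),
    HasPairing K (coefficient lam f g) (∫ s, (B (f.toLp 2 volume) : Rn n → ℂ) s * g s)

end FlagKernel

end

/-!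
The proof diagonalizes `Op(K)` by explicit wave packets. Let `m` be the multiplier of `K`, and for a
Schwartz function `g` on `ℝⁿ` let
`quant m g (η, λ) = ∫ m (λu, η, λ) e^{-2πi u η} g(u) du`.
Up to a dilation of `ℝⁿ` and the sign of `λ`, the map `ĝ ↦ quant m g (·, λ)` is the operator `π_K^λ`,
in its form as a pseudodifferential operator with a Kohn-Nirenberg symbol (`repFun_eq`,
`hasPairing_coefficient`).

If the Fourier transform of `F` is the left wave `α(ξ) e^{2πi ξη/λ} χ(λ) ĝ(η)`, where `χ` is a smooth
cutoff supported away from `λ = 0`, then the Fourier transform of `K ⋆ F` is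
`α(ξ) e^{2πi ξη/λ} χ(λ) quant m g (η, λ)` (`convolution_leftWave`). This is a computation with Fubini's
theorem: the left translates of `F` are the Fourier transforms of the right waves
`|λ|⁻ⁿ g(ξ/λ) e^{-2πi ξη/λ} c(η, λ)` (`fourierInv_leftWave_translate`), and pairing `m` with a right
wave produces `quant m g` (`integral_mul_rightWave`).

By Plancherel's theorem, the boundedness of `Op(K)` and of its inverse turns into two-sided bounds for
the integrals of `χ(λ)² ‖quant m g (·, λ)‖²` over `λ`. The bounds hold at each single `λ ≠ 0`
(`quant_bounds`), since `λ ↦ ‖quant m g (·, λ)‖²` is continuous there. It is for this continuity that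
the flag estimates are needed: integration by parts shows that `quant m g` is rapidly decreasing in `η`,
locally uniformly in `λ ≠ 0` (`exists_quant_decay`). No further theorem on the boundedness of
pseudodifferential operators is used.

Evaluating the symmetry `K = K⋆` on the same wave packets shows that the operators are symmetric at
each `λ ≠ 0` (`quant_symmetric`). A bounded symmetric operator that is bounded below is invertible
(`exists_equiv_of_symmetric`), and the norm of the inverse of `π_K^λ` is at most the norm of the
inverse of `Op(K)` (`exists_rep_equiv`).
-/

noncomputable section

namespace FlagKernel

variable {n : ℕ}

/-! ### Characters and coordinates -/

/-- The character `θ ↦ e^{2πiθ}` of the real line. -/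
def chi (θ : ℝ) : ℂ := Complex.exp (2 * Real.pi * Complex.I * (θ : ℝ))

theorem chi_add (a b : ℝ) : chi (a + b) = chi a * chi b := by
  simp only [chi, ← Complex.exp_add]; congr 1; push_cast; ring

@[simp] theorem chi_zero : chi 0 = 1 := by simp [chi]

@[simp] theorem norm_chi (a : ℝ) : ‖chi a‖ = 1 := by
  rw [chi, Complex.norm_exp]; simp

theorem conj_chi (a : ℝ) : conj (chi a) = chi (-a) := by
  rw [chi, ← Complex.exp_conj, chi]
  congr 1
  simp [map_ofNat]

theorem contDiff_chi : ContDiff ℝ ∞ chi := by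
  unfold chi
  exact (contDiff_const.mul Complex.ofRealCLM.contDiff).cexp

@[fun_prop] theorem continuous_chi : Continuous chi := contDiff_chi.continuous

@[fun_prop] theorem measurable_chi : Measurable chi := continuous_chi.measurable

theorem fourier_eq_chi {V : Type*} [NormedAddCommGroup V] [InnerProductSpace ℝ V]
    [MeasurableSpace V] [BorelSpace V] [FiniteDimensional ℝ V] (f : V → ℂ) (w : V) :
    𝓕 f w = ∫ v, chi (-inner ℝ v w) * f v := by
  rw [Real.fourier_eq']
  refine integral_congr_ae (Filter.Eventually.of_forall fun v => ?_)
  simp only [chi, smul_eq_mul]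
  congr 2; push_cast; ring

theorem fourierInv_eq_chi {V : Type*} [NormedAddCommGroup V] [InnerProductSpace ℝ V]
    [MeasurableSpace V] [BorelSpace V] [FiniteDimensional ℝ V] (f : V → ℂ) (w : V) :
    𝓕⁻ f w = ∫ v, chi (inner ℝ v w) * f v := by
  rw [Real.fourierInv_eq']
  refine integral_congr_ae (Filter.Eventually.of_forall fun v => ?_)
  simp only [chi, smul_eq_mul]
  congr 2; push_cast; ring

theorem inner_eq_coord (h ζ : Heis n) :
    inner ℝ h ζ = inner ℝ (xc h) (xc ζ) + inner ℝ (yc h) (yc ζ) + tc h * tc ζ := by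
  simp [PiLp.inner_apply, Fintype.sum_sum_type, xc, yc, tc, mul_comm]

@[fun_prop] theorem continuous_xc : Continuous (xc : Heis n → Rn n) := by
  unfold xc; fun_prop

@[fun_prop] theorem continuous_yc : Continuous (yc : Heis n → Rn n) := by
  unfold yc; fun_prop

@[fun_prop] theorem continuous_tc : Continuous (tc : Heis n → ℝ) := by
  unfold tc; fun_prop

theorem continuous_mk_prod : Continuous fun p : Rn n × (Rn n × ℝ) => mk p.1 p.2.1 p.2.2 := by
  refine (PiLp.continuous_toLp 2 _).comp (continuous_pi ?_)
  rintro ((i | i) | u) <;> simp only [Sum.elim_inl, Sum.elim_inr] <;> fun_prop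

@[fun_prop] theorem continuous_heis_mk {T : Type*} [TopologicalSpace T] {a b : T → Rn n}
    {c : T → ℝ} (ha : Continuous a) (hb : Continuous b) (hc : Continuous c) :
    Continuous fun t => mk (a t) (b t) (c t) :=
  continuous_mk_prod.comp (ha.prodMk (hb.prodMk hc))

@[fun_prop] theorem measurable_heis_mk {T : Type*} [MeasurableSpace T] {a b : T → Rn n}
    {c : T → ℝ} (ha : Measurable a) (hb : Measurable b) (hc : Measurable c) :
    Measurable fun t => mk (a t) (b t) (c t) :=
  continuous_mk_prod.measurable.comp (ha.prodMk (hb.prodMk hc))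

/-- The coordinates `(ξ, (η, λ))` of the dual space, with the last two grouped together. -/
def coord (n : ℕ) : Rn n × (Rn n × ℝ) ≃ᵐ Heis n where
  toFun p := mk p.1 p.2.1 p.2.2
  invFun ζ := (xc ζ, (yc ζ, tc ζ))
  left_inv p := rfl
  right_inv ζ := ext_coord rfl rfl rfl
  measurable_toFun := continuous_mk_prod.measurable
  measurable_invFun := by
    change Measurable fun ζ : Heis n => (xc ζ, (yc ζ, tc ζ))
    exact (by fun_prop : Continuous fun ζ : Heis n => (xc ζ, (yc ζ, tc ζ))).measurable

@[simp] theorem coord_apply (p : Rn n × (Rn n × ℝ)) : coord n p = mk p.1 p.2.1 p.2.2 := rfl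

theorem measurePreserving_coord_symm : MeasurePreserving (coord n).symm := by
  have h1 := PiLp.volume_preserving_ofLp ((Fin n ⊕ Fin n) ⊕ Unit)
  have h2 := volume_measurePreserving_sumPiEquivProdPi
    (fun _ : (Fin n ⊕ Fin n) ⊕ Unit => ℝ)
  have h3 := volume_measurePreserving_sumPiEquivProdPi (fun _ : Fin n ⊕ Fin n => ℝ)
  have h4 := volume_preserving_funUnique Unit ℝ
  have h5 := PiLp.volume_preserving_toLp (Fin n)
  have h6 := (((h5.prod h5).comp h3).prod h4).comp (h2.comp h1)
  have h7 := (volume_preserving_prodAssoc (α₁ := Rn n) (β₁ := Rn n) (γ₁ := ℝ)).comp h6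
  exact h7

theorem measurePreserving_coord : MeasurePreserving (coord n) :=
  measurePreserving_coord_symm.symm

theorem integral_heis (f : Heis n → ℂ) :
    ∫ ζ, f ζ = ∫ p : Rn n × (Rn n × ℝ), f (mk p.1 p.2.1 p.2.2) :=
  (measurePreserving_coord.integral_comp' f).symm

theorem integrable_heis_iff {f : Heis n → ℂ} :
    Integrable f ↔ Integrable fun p : Rn n × (Rn n × ℝ) => f (mk p.1 p.2.1 p.2.2) :=
  (measurePreserving_coord.integrable_comp_emb (coord n).measurableEmbedding).symm

theorem ae_tc_ne : ∀ᵐ ζ : Heis n, tc ζ ≠ 0 := by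
  have h : ∀ᵐ p : Rn n × (Rn n × ℝ), p.2.2 ≠ 0 :=
    (Measure.quasiMeasurePreserving_snd.comp Measure.quasiMeasurePreserving_snd).ae
      (Measure.ae_ne volume (0 : ℝ))
  exact measurePreserving_coord_symm.quasiMeasurePreserving.ae h

theorem ae_snd_ne : ∀ᵐ z : Rn n × ℝ, z.2 ≠ 0 :=
  Measure.quasiMeasurePreserving_snd.ae (Measure.ae_ne volume (0 : ℝ))

/-! ### Left waves and right waves -/

/-- The operator with symbol `m` at the level `λ`, on the Fourier transform side: it takes `ĝ` to
`η ↦ ∫ m (λu, η, λ) e^{-2πi u η} g(u) du`. The argument `z` is `(η, λ)`. -/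
def quant (m : Heis n → ℂ) (g : Rn n → ℂ) (z : Rn n × ℝ) : ℂ :=
  ∫ u, m (mk (z.2 • u) z.1 z.2) * chi (-inner ℝ u z.1) * g u

/-- The function `(ξ, η, λ) ↦ |λ|⁻ⁿ g(ξ/λ) e^{-2πi ξη/λ} c(η, λ)`. -/
def rightWave (g : Rn n → ℂ) (c : Rn n × ℝ → ℂ) (ζ : Heis n) : ℂ :=
  ((|tc ζ| ^ n)⁻¹ : ℝ) * g ((tc ζ)⁻¹ • xc ζ) * chi (-((tc ζ)⁻¹ * inner ℝ (xc ζ) (yc ζ))) *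
    c (yc ζ, tc ζ)

/-- The function `(ξ, η, λ) ↦ a(ξ) e^{2πi ξη/λ} d(η, λ)`. -/
def leftWave (a : Rn n → ℂ) (d : Rn n × ℝ → ℂ) (ζ : Heis n) : ℂ :=
  a (xc ζ) * chi ((tc ζ)⁻¹ * inner ℝ (xc ζ) (yc ζ)) * d (yc ζ, tc ζ)

theorem integral_inv_smul_scale (f : Rn n → ℂ) {r : ℝ} (hr : r ≠ 0) :
    ∫ x, ((|r| ^ n)⁻¹ : ℝ) * f (r⁻¹ • x) = ∫ x, f x := by
  rw [integral_const_mul, Measure.integral_comp_inv_smul, finrank_euclideanSpace_fin, abs_pow]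
  have : |r| ^ n ≠ 0 := pow_ne_zero _ (abs_ne_zero.2 hr)
  rw [Complex.real_smul, ← mul_assoc, ← Complex.ofReal_mul, inv_mul_cancel₀ this]
  simp

theorem integrable_rightWave {g : Rn n → ℂ} (hg : Integrable g) (hgm : Measurable g)
    {c : Rn n × ℝ → ℂ} (hc : Integrable c) : Integrable (rightWave g c) := by
  rw [integrable_heis_iff]
  have hm : AEStronglyMeasurable
      (fun p : Rn n × (Rn n × ℝ) => rightWave g c (mk p.1 p.2.1 p.2.2)) := by
    unfold rightWave
    simp only [xc_mk, yc_mk, tc_mk]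
    refine AEStronglyMeasurable.mul ?_ (hc.aestronglyMeasurable.comp_snd)
    refine Measurable.aestronglyMeasurable ?_
    fun_prop
  rw [Measure.volume_eq_prod, integrable_prod_iff' (by simpa [Measure.volume_eq_prod] using hm)]
  constructor
  · filter_upwards [ae_snd_ne (n := n)] with z hz
    have h1 : Integrable fun x => g (z.2⁻¹ • x) := by
      exact (integrable_comp_smul_iff volume g (inv_ne_zero hz)).2 hg
    unfold rightWave
    simp only [xc_mk, yc_mk, tc_mk]
    have h2 : Integrable fun x => chi (-(z.2⁻¹ * inner ℝ x z.1)) * g (z.2⁻¹ • x) :=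
      h1.bdd_mul (c := 1) (by fun_prop) (Filter.Eventually.of_forall fun x => by simp)
    refine ((h2.const_mul (((|z.2| ^ n)⁻¹ : ℝ) : ℂ)).mul_const (c z)).congr ?_
    exact Filter.Eventually.of_forall fun x => by simp only [Prod.mk.eta]; ring
  · refine (hc.norm.const_mul (∫ x, ‖g x‖)).congr ?_
    filter_upwards [ae_snd_ne (n := n)] with z hz
    have h3 : |z.2| ^ n ≠ 0 := pow_ne_zero _ (abs_ne_zero.2 hz)
    have h4 : ∀ x, ‖rightWave g c (mk x z.1 z.2)‖ =
        ((|z.2| ^ n)⁻¹ * ‖c z‖) * ‖g (z.2⁻¹ • x)‖ := by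
      intro x
      simp [rightWave]
      ring
    simp only [h4]
    rw [integral_const_mul, Measure.integral_comp_inv_smul volume (fun x => ‖g x‖),
      finrank_euclideanSpace_fin, abs_pow, smul_eq_mul]
    field_simp

/-- Pairing a bounded symbol with `rightWave g c` amounts to pairing `quant m g` with `c`. -/
theorem integral_mul_rightWave {m : Heis n → ℂ} (hm : Measurable m) {M : ℝ} (hM : ∀ ζ, ‖m ζ‖ ≤ M)
    {g : Rn n → ℂ} (hg : Integrable g) (hgm : Measurable g)
    {c : Rn n × ℝ → ℂ} (hc : Integrable c) :
    ∫ ζ, m ζ * rightWave g c ζ = ∫ z, quant m g z * c z := by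
  have hi : Integrable fun ζ => m ζ * rightWave g c ζ :=
    (integrable_rightWave hg hgm hc).bdd_mul hm.aestronglyMeasurable (Filter.Eventually.of_forall hM)
  rw [integrable_heis_iff] at hi
  rw [integral_heis, Measure.volume_eq_prod, integral_prod_symm _ hi]
  refine integral_congr_ae ?_
  filter_upwards [ae_snd_ne (n := n)] with z hz
  have h5 := integral_inv_smul_scale
    (fun u => m (mk (z.2 • u) z.1 z.2) * chi (-inner ℝ u z.1) * g u) hz
  rw [quant, ← h5, ← integral_mul_const]
  refine integral_congr_ae (Filter.Eventually.of_forall fun x => ?_)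
  simp only [rightWave, xc_mk, yc_mk, tc_mk, smul_inv_smul₀ hz, inner_smul_left,
    RCLike.conj_to_real]
  ring

/-- `quant` for the symbol `e^{-2πi k ζ}`, which belongs to a point mass at `k`. -/
theorem quant_chi (k : Heis n) (g : Rn n → ℂ) (z : Rn n × ℝ) :
    quant (fun ζ => chi (-inner ℝ ζ k)) g z =
      chi (-(inner ℝ (yc k) z.1 + tc k * z.2)) * 𝓕 g (z.2 • xc k + z.1) := by
  rw [quant, fourier_eq_chi, ← integral_const_mul]
  refine integral_congr_ae (Filter.Eventually.of_forall fun u => ?_)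
  simp only [inner_eq_coord, xc_mk, yc_mk, tc_mk]
  rw [← chi_add, ← mul_assoc, ← chi_add]
  congr 2
  simp only [inner_smul_left, inner_smul_right, inner_add_right, RCLike.conj_to_real,
    real_inner_comm (yc k) z.1]
  ring

theorem fourier_rightWave {g : Rn n → ℂ} (hg : Integrable g) (hgm : Measurable g)
    {c : Rn n × ℝ → ℂ} (hc : Integrable c) (k : Heis n) :
    𝓕 (rightWave g c) k =
      ∫ z : Rn n × ℝ, chi (-(inner ℝ (yc k) z.1 + tc k * z.2)) * 𝓕 g (z.2 • xc k + z.1) * c z := by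
  rw [fourier_eq_chi, integral_mul_rightWave (M := 1) (by fun_prop) (fun ζ => by simp) hg hgm hc]
  simp only [quant_chi]

theorem integrable_leftWave {a : Rn n → ℂ} (ha : Integrable a) {d : Rn n × ℝ → ℂ}
    (hd : Integrable d) : Integrable (leftWave a d) := by
  rw [integrable_heis_iff]
  have h1 := ha.mul_prod hd
  have h2 := h1.bdd_mul (c := 1)
    (f := fun p : Rn n × (Rn n × ℝ) => chi (p.2.2⁻¹ * inner ℝ p.1 p.2.1))
    (Measurable.aestronglyMeasurable (by fun_prop)) (Filter.Eventually.of_forall fun x => by simp)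
  refine h2.congr (Filter.Eventually.of_forall fun p => ?_)
  simp only [leftWave, xc_mk, yc_mk, tc_mk, Prod.mk.eta]
  ring

theorem fourierInv_leftWave {a : Rn n → ℂ} (ha : Integrable a) {d : Rn n × ℝ → ℂ}
    (hd : Integrable d) (h : Heis n) :
    𝓕⁻ (leftWave a d) h =
      ∫ z : Rn n × ℝ, chi (inner ℝ (yc h) z.1 + tc h * z.2) * d z *
        𝓕⁻ a (xc h + z.2⁻¹ • z.1) := by
  have hi : Integrable fun ζ => chi (inner ℝ ζ h) * leftWave a d ζ :=
    (integrable_leftWave ha hd).bdd_mul (c := 1) (by fun_prop)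
      (Filter.Eventually.of_forall fun x => by simp)
  rw [integrable_heis_iff] at hi
  rw [fourierInv_eq_chi, integral_heis, Measure.volume_eq_prod, integral_prod_symm _ hi]
  refine integral_congr_ae (Filter.Eventually.of_forall fun z => ?_)
  simp only []
  rw [fourierInv_eq_chi, ← integral_const_mul]
  refine integral_congr_ae (Filter.Eventually.of_forall fun x => ?_)
  simp only [leftWave, inner_eq_coord, xc_mk, yc_mk, tc_mk]
  rw [inner_add_right, inner_smul_right, chi_add (inner ℝ x (xc h)), add_assoc, chi_add,
    real_inner_comm z.1 (yc h), mul_comm z.2]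
  ring

theorem integral_norm_sq_leftWave {a : Rn n → ℂ} {d : Rn n × ℝ → ℂ} :
    ∫ ζ, ‖leftWave a d ζ‖ ^ 2 = (∫ x, ‖a x‖ ^ 2) * ∫ z, ‖d z‖ ^ 2 := by
  rw [← integral_prod_mul, ← Measure.volume_eq_prod,
    ← measurePreserving_coord.integral_comp' (fun ζ => ‖leftWave a d ζ‖ ^ 2)]
  refine integral_congr_ae (Filter.Eventually.of_forall fun p => ?_)
  simp [leftWave, mul_pow]

theorem memLp_leftWave {a : Rn n → ℂ} (ha : MemLp a 2) {d : Rn n × ℝ → ℂ}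
    (hd : MemLp d 2) : MemLp (leftWave a d) 2 := by
  have hm : AEStronglyMeasurable (leftWave a d) := by
    have h1 : AEStronglyMeasurable fun p : Rn n × (Rn n × ℝ) =>
        leftWave a d (mk p.1 p.2.1 p.2.2) := by
      unfold leftWave
      simp only [xc_mk, yc_mk, tc_mk]
      exact ((ha.aestronglyMeasurable.comp_fst).mul
        (Measurable.aestronglyMeasurable (by fun_prop))).mul hd.aestronglyMeasurable.comp_snd
    exact (measurePreserving_coord.aestronglyMeasurable_comp_iff
      (coord n).measurableEmbedding).1 h1
  rw [memLp_two_iff_integrable_sq_norm hm]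
  rw [memLp_two_iff_integrable_sq_norm ha.aestronglyMeasurable] at ha
  rw [memLp_two_iff_integrable_sq_norm hd.aestronglyMeasurable] at hd
  refine (measurePreserving_coord.integrable_comp_emb (coord n).measurableEmbedding).1 ?_
  refine (ha.mul_prod hd).congr (Filter.Eventually.of_forall fun p => ?_)
  simp [leftWave, mul_pow]

/-! ### Left waves that are Schwartz functions -/

theorem norm_iteratedFDeriv_comp_clm_le {E F : Type*} [NormedAddCommGroup E] [NormedSpace ℝ E]
    [NormedAddCommGroup F] [NormedSpace ℝ F] (p : E →L[ℝ] F) (f : 𝓢(F, ℂ)) (i : ℕ) (x : E) :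
    ‖iteratedFDeriv ℝ i (fun x => f (p x)) x‖ ≤ ‖iteratedFDeriv ℝ i f (p x)‖ * ‖p‖ ^ i := by
  have h := p.iteratedFDeriv_comp_right (f.smooth ⊤) x (i := i) (by exact_mod_cast le_top)
  change ‖iteratedFDeriv ℝ i (f ∘ p) x‖ ≤ _
  rw [h]
  simpa using
    (iteratedFDeriv ℝ i f (p x)).norm_compContinuousLinearMap_le (fun _ => p)

/-- The tensor product of two Schwartz functions is a Schwartz function. -/
theorem exists_schwartz_tensor {E E₁ E₂ : Type*} [NormedAddCommGroup E] [NormedSpace ℝ E]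
    [NormedAddCommGroup E₁] [NormedSpace ℝ E₁] [NormedAddCommGroup E₂] [NormedSpace ℝ E₂]
    (p₁ : E →L[ℝ] E₁) (p₂ : E →L[ℝ] E₂) {C : ℝ} (hC : 0 ≤ C)
    (hp : ∀ x, ‖x‖ ≤ C * (‖p₁ x‖ + ‖p₂ x‖))
    (f₁ : 𝓢(E₁, ℂ)) (f₂ : 𝓢(E₂, ℂ)) :
    ∃ F : 𝓢(E, ℂ), ∀ x, F x = f₁ (p₁ x) * f₂ (p₂ x) := by
  have s₁ : ContDiff ℝ ∞ fun x => f₁ (p₁ x) := (f₁.smooth ⊤).comp p₁.contDiff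
  have s₂ : ContDiff ℝ ∞ fun x => f₂ (p₂ x) := (f₂.smooth ⊤).comp p₂.contDiff
  refine ⟨⟨fun x => f₁ (p₁ x) * f₂ (p₂ x), s₁.mul s₂, fun k l => ?_⟩, fun x => rfl⟩
  let S (j i : ℕ) := SchwartzMap.seminorm ℝ j i f₁ * ‖p₁‖ ^ i
  let T (j i : ℕ) := SchwartzMap.seminorm ℝ j i f₂ * ‖p₂‖ ^ i
  have hS : ∀ j i x, ‖p₁ x‖ ^ j * ‖iteratedFDeriv ℝ i (fun x => f₁ (p₁ x)) x‖ ≤ S j i := by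
    intro j i x
    calc _ ≤ ‖p₁ x‖ ^ j * (‖iteratedFDeriv ℝ i f₁ (p₁ x)‖ * ‖p₁‖ ^ i) := by
          gcongr; exact norm_iteratedFDeriv_comp_clm_le p₁ f₁ i x
      _ = (‖p₁ x‖ ^ j * ‖iteratedFDeriv ℝ i f₁ (p₁ x)‖) * ‖p₁‖ ^ i := by ring
      _ ≤ S j i := by exact mul_le_mul_of_nonneg_right (f₁.le_seminorm ℝ j i (p₁ x)) (by positivity)
  have hT : ∀ j i x, ‖p₂ x‖ ^ j * ‖iteratedFDeriv ℝ i (fun x => f₂ (p₂ x)) x‖ ≤ T j i := by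
    intro j i x
    calc _ ≤ ‖p₂ x‖ ^ j * (‖iteratedFDeriv ℝ i f₂ (p₂ x)‖ * ‖p₂‖ ^ i) := by
          gcongr; exact norm_iteratedFDeriv_comp_clm_le p₂ f₂ i x
      _ = (‖p₂ x‖ ^ j * ‖iteratedFDeriv ℝ i f₂ (p₂ x)‖) * ‖p₂‖ ^ i := by ring
      _ ≤ T j i := by exact mul_le_mul_of_nonneg_right (f₂.le_seminorm ℝ j i (p₂ x)) (by positivity)
  refine ⟨∑ i ∈ Finset.range (l + 1), (l.choose i : ℝ) *
    (C ^ k * 2 ^ (k - 1) * (S k i * T 0 (l - i) + S 0 i * T k (l - i))), fun x => ?_⟩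
  have h1 := norm_iteratedFDeriv_mul_le (n := l) s₁ s₂ x (by exact_mod_cast le_top)
  refine (mul_le_mul_of_nonneg_left h1 (by positivity)).trans ?_
  rw [Finset.mul_sum]
  refine Finset.sum_le_sum fun i _ => ?_
  set u := ‖iteratedFDeriv ℝ i (fun x => f₁ (p₁ x)) x‖
  set v := ‖iteratedFDeriv ℝ (l - i) (fun x => f₂ (p₂ x)) x‖
  have hu : 0 ≤ u := norm_nonneg _
  have hv : 0 ≤ v := norm_nonneg _
  have h2 : ‖x‖ ^ k ≤ C ^ k * 2 ^ (k - 1) * (‖p₁ x‖ ^ k + ‖p₂ x‖ ^ k) := by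
    refine (pow_le_pow_left₀ (norm_nonneg x) (hp x) k).trans ?_
    rw [mul_pow, mul_assoc]
    exact mul_le_mul_of_nonneg_left (add_pow_le (norm_nonneg _) (norm_nonneg _) k)
      (pow_nonneg hC k)
  have a1 : ‖p₁ x‖ ^ k * u ≤ S k i := hS k i x
  have a2 : u ≤ S 0 i := by simpa using hS 0 i x
  have a3 : ‖p₂ x‖ ^ k * v ≤ T k (l - i) := hT k (l - i) x
  have a4 : v ≤ T 0 (l - i) := by simpa using hT 0 (l - i) x
  calc ‖x‖ ^ k * (l.choose i * u * v)
      ≤ (C ^ k * 2 ^ (k - 1) * (‖p₁ x‖ ^ k + ‖p₂ x‖ ^ k)) * (l.choose i * u * v) := by gcongr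
    _ = l.choose i * (C ^ k * 2 ^ (k - 1) * ((‖p₁ x‖ ^ k * u) * v + u * (‖p₂ x‖ ^ k * v))) := by ring
    _ ≤ _ := by
      have b1 := mul_le_mul a1 a4 hv ((by positivity : 0 ≤ ‖p₁ x‖ ^ k * u).trans a1)
      have b2 := mul_le_mul a2 a3 (by positivity) (hu.trans a2)
      gcongr

/-- A smooth function on the line whose support is bounded and bounded away from `0`. -/
structure IsCutoff (χ : ℝ → ℝ) (δ R : ℝ) : Prop where
  smooth : ContDiff ℝ ∞ χ
  pos : 0 < δ
  bounds : ∀ t, χ t ≠ 0 → δ ≤ |t| ∧ |t| ≤ R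

theorem IsCutoff.hasCompactSupport {χ : ℝ → ℝ} {δ R : ℝ} (h : IsCutoff χ δ R) :
    HasCompactSupport χ :=
  HasCompactSupport.intro (isCompact_closedBall (0 : ℝ) R) fun t ht => by
    by_contra h0
    exact ht (by simpa using (h.bounds t h0).2)

/-- The function `1/λ`, modified outside the support of a cutoff function so as to be smooth with
compact support. -/
theorem exists_smooth_inv {δ : ℝ} (hδ : 0 < δ) (R : ℝ) :
    ∃ κ : ℝ → ℝ, ContDiff ℝ ∞ κ ∧ HasCompactSupport κ ∧
      ∀ t, δ ≤ |t| → |t| ≤ R → κ t = t⁻¹ := by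
  let b : ContDiffBump (0 : ℝ) := ⟨max R 1, max R 1 + 1, by positivity, by linarith⟩
  let s (t : ℝ) : ℝ := Real.smoothTransition (2 * (t / δ) ^ 2 - 1)
  have hs : ContDiff ℝ ∞ s := Real.smoothTransition.contDiff.comp (by fun_prop)
  refine ⟨fun t => (t⁻¹ * s t) * b t, ContDiff.mul ?_ b.contDiff,
    b.hasCompactSupport.mul_left, fun t h1 h2 => ?_⟩
  · rw [contDiff_iff_contDiffAt]
    intro t
    by_cases ht : t = 0
    · subst ht
      refine (contDiffAt_const (c := (0 : ℝ))).congr_of_eventuallyEq ?_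
      have hc : ContinuousAt (fun t : ℝ => 2 * (t / δ) ^ 2 - 1) 0 := by fun_prop
      have : ∀ᶠ t in nhds (0 : ℝ), 2 * (t / δ) ^ 2 - 1 < 0 :=
        hc.eventually_lt continuousAt_const (by norm_num)
      filter_upwards [this] with t ht
      simp [s, Real.smoothTransition.zero_of_nonpos ht.le]
    · exact (contDiffAt_inv ℝ ht).mul hs.contDiffAt
  · have e1 : s t = 1 := by
      apply Real.smoothTransition.one_of_one_le
      have : 1 ≤ (t / δ) ^ 2 := by
        rw [div_pow, one_le_div (by positivity), ← sq_abs t]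
        exact pow_le_pow_left₀ hδ.le h1 2
      linarith
    have e2 : b t = 1 := b.one_of_mem_closedBall (by
      simp only [mem_closedBall_zero_iff, Real.norm_eq_abs, b]; exact h2.trans (le_max_left _ _))
    simp [e1, e2]

theorem temperate_chi : Function.HasTemperateGrowth chi := by
  refine ⟨contDiff_chi, fun k => ⟨0, (2 * Real.pi) ^ k, fun x => ?_⟩⟩
  have h : ∀ k : ℕ, iteratedDeriv k chi =
      fun θ => (2 * Real.pi * Complex.I) ^ k * chi θ := by
    intro k
    induction k with
    | zero => simp
    | succ k ih =>
      rw [iteratedDeriv_succ, ih]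
      funext θ
      have h1 : HasDerivAt (fun t : ℝ => (2 * Real.pi * Complex.I * (t : ℝ) : ℂ))
          (2 * Real.pi * Complex.I) θ := by
        simpa using (Complex.ofRealCLM.hasDerivAt (x := θ)).const_mul
          (2 * Real.pi * Complex.I : ℂ)
      have h2 : HasDerivAt chi (chi θ * (2 * Real.pi * Complex.I)) θ := h1.cexp
      rw [(h2.const_mul _).deriv]
      ring
  rw [norm_iteratedFDeriv_eq_norm_iteratedDeriv, h]
  simp [abs_of_pos Real.pi_pos]

/-- The projection `(x, y, t) ↦ x` as a continuous linear map. -/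
def xcL (n : ℕ) : Heis n →L[ℝ] Rn n :=
  { toFun := xc, map_add' := fun _ _ => rfl, map_smul' := fun _ _ => rfl, cont := continuous_xc }

/-- The projection `(x, y, t) ↦ y` as a continuous linear map. -/
def ycL (n : ℕ) : Heis n →L[ℝ] Rn n :=
  { toFun := yc, map_add' := fun _ _ => rfl, map_smul' := fun _ _ => rfl, cont := continuous_yc }

/-- The projection `(x, y, t) ↦ t` as a continuous linear map. -/
def tcL (n : ℕ) : Heis n →L[ℝ] ℝ :=
  { toFun := tc, map_add' := fun _ _ => rfl, map_smul' := fun _ _ => rfl, cont := continuous_tc }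

theorem exists_schwartz_leftWave (α γ : 𝓢(Rn n, ℂ)) {χ : ℝ → ℝ} {δ R : ℝ}
    (hχ : IsCutoff χ δ R) :
    ∃ Φ : 𝓢(Heis n, ℂ), ∀ ζ, Φ ζ = leftWave α (fun z => (χ z.2 : ℂ) * γ z.1) ζ := by
  have hc : HasCompactSupport fun t => (χ t : ℂ) :=
    hχ.hasCompactSupport.comp_left (g := fun r : ℝ => (r : ℂ)) (by simp)
  let X : 𝓢(ℝ, ℂ) := hc.toSchwartzMap (Complex.ofRealCLM.contDiff.comp hχ.smooth)
  obtain ⟨F₁, h₁⟩ := exists_schwartz_tensor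
    (ContinuousLinearMap.fst ℝ ℝ (Rn n)) (ContinuousLinearMap.snd ℝ ℝ (Rn n))
    zero_le_one (fun x => by
      rw [Prod.norm_def, one_mul]
      exact max_le (le_add_of_nonneg_right (norm_nonneg _))
        (le_add_of_nonneg_left (norm_nonneg _))) X γ
  obtain ⟨F₂, h₂⟩ := exists_schwartz_tensor (xcL n) ((tcL n).prod (ycL n)) zero_le_two
    (fun ζ => by
      change ‖ζ‖ ≤ 2 * (‖xc ζ‖ + ‖(tc ζ, yc ζ)‖)
      have e := norm_le_sum ζ
      have e3 : |tc ζ| ≤ ‖(tc ζ, yc ζ)‖ := norm_fst_le (tc ζ, yc ζ)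
      have e4 : ‖yc ζ‖ ≤ ‖(tc ζ, yc ζ)‖ := norm_snd_le (tc ζ, yc ζ)
      have := norm_nonneg (xc ζ)
      linarith) α F₁
  -- On the support of `χ` the singular factor `1/λ` in the phase may be replaced by the smooth `κ`,
  -- so that the exponential has temperate growth.
  obtain ⟨κ, k1, k2, k3⟩ := exists_smooth_inv hχ.pos R
  have hθ : Function.HasTemperateGrowth
      fun ζ : Heis n => chi (κ (tc ζ) * inner ℝ (xc ζ) (yc ζ)) := by
    refine temperate_chi.comp ((Function.HasTemperateGrowth.comp
      (k2.hasTemperateGrowth k1) (tcL n).hasTemperateGrowth).mul ?_)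
    have : (fun ζ : Heis n => inner ℝ (xc ζ) (yc ζ)) =
        fun ζ => ∑ i, ζ (Sum.inl (Sum.inl i)) * ζ (Sum.inl (Sum.inr i)) := by
      funext ζ; simp [PiLp.inner_apply, xc, yc, mul_comm]
    rw [this]
    exact Function.HasTemperateGrowth.sum fun i _ =>
      (temperate_coord _).mul (temperate_coord _)
  refine ⟨SchwartzMap.smulLeftCLM ℂ
    (fun ζ : Heis n => chi (κ (tc ζ) * inner ℝ (xc ζ) (yc ζ))) F₂, fun ζ => ?_⟩
  rw [SchwartzMap.smulLeftCLM_apply_apply hθ, h₂]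
  change _ • (α (xc ζ) * F₁ (tc ζ, yc ζ)) = _
  rw [h₁]
  change _ • (α (xc ζ) * ((χ (tc ζ) : ℂ) * γ (yc ζ))) = _
  simp only [leftWave, smul_eq_mul]
  by_cases h0 : χ (tc ζ) = 0
  · simp [h0]
  · rw [k3 _ (hχ.bounds _ h0).1 (hχ.bounds _ h0).2]
    ring

/-! ### Convolution of a flag kernel with a wave packet -/

theorem IsCutoff.integrable {χ : ℝ → ℝ} {δ R : ℝ} (h : IsCutoff χ δ R) :
    Integrable fun t => (χ t : ℂ) :=
  (h.smooth.continuous.integrable_of_hasCompactSupport h.hasCompactSupport).ofReal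

/-- The function `(η, λ) ↦ χ(λ) e^{2πi(yη + tλ)} b(x + η/λ)`. -/
def waveCoeff (χ : ℝ → ℝ) (b : 𝓢(Rn n, ℂ)) (h : Heis n) (z : Rn n × ℝ) : ℂ :=
  chi (inner ℝ (yc h) z.1 + tc h * z.2) * χ z.2 * b (xc h + z.2⁻¹ • z.1)

theorem integrable_waveCoeff {χ : ℝ → ℝ} {δ R : ℝ} (hχ : IsCutoff χ δ R) (b : 𝓢(Rn n, ℂ))
    (h : Heis n) : Integrable (waveCoeff χ b h) := by
  have c1 := hχ.smooth.continuous
  have hm : AEStronglyMeasurable (waveCoeff χ b h) := by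
    have hb : Measurable b := b.continuous.measurable
    have hχm := c1.measurable
    unfold waveCoeff
    exact Measurable.aestronglyMeasurable (by fun_prop)
  rw [Measure.volume_eq_prod, integrable_prod_iff' (by simpa [Measure.volume_eq_prod] using hm)]
  have key : ∀ t : ℝ, t ≠ 0 → Integrable fun y : Rn n => b (xc h + t⁻¹ • y) := fun t ht =>
    (integrable_comp_smul_iff volume (fun y => b (xc h + y)) (inv_ne_zero ht)).2
      (b.integrable.comp_add_left (xc h))
  constructor
  · filter_upwards [Measure.ae_ne volume (0 : ℝ)] with t ht
    have h2 : Integrable fun y => chi (inner ℝ (yc h) y + tc h * t) * b (xc h + t⁻¹ • y) :=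
      (key t ht).bdd_mul (c := 1) (by fun_prop) (Filter.Eventually.of_forall fun x => by simp)
    refine (h2.const_mul (χ t : ℂ)).congr (Filter.Eventually.of_forall fun y => ?_)
    simp only [waveCoeff]; ring
  · have h3 : Integrable fun t => |χ t| * |t| ^ n * ∫ y, ‖b y‖ := by
      refine Integrable.mul_const ?_ _
      refine Continuous.integrable_of_hasCompactSupport (by fun_prop) ?_
      exact (hχ.hasCompactSupport.comp_left (g := fun r => |r|) abs_zero).mul_right
    refine h3.congr ?_
    filter_upwards [Measure.ae_ne volume (0 : ℝ)] with t ht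
    have h4 : ∀ y, ‖waveCoeff χ b h (y, t)‖ = |χ t| * ‖b (xc h + t⁻¹ • y)‖ := by
      intro y; simp [waveCoeff]
    simp only [h4]
    rw [integral_const_mul,
      Measure.integral_comp_inv_smul volume (fun y => ‖b (xc h + y)‖),
      integral_add_left_eq_self (fun y => ‖b y‖), finrank_euclideanSpace_fin, abs_pow, smul_eq_mul]
    ring

theorem norm_apply_le_of_schwartz (b : 𝓢(Rn n, ℂ)) (x : Rn n) :
    ‖b x‖ ≤ SchwartzMap.seminorm ℝ 0 0 b := SchwartzMap.norm_le_seminorm ℝ b x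

/-- If the Fourier transform of `F` is a left wave, then `k ↦ F (k⁻¹ h)` is the Fourier transform of
a right wave. -/
theorem fourierInv_leftWave_translate {χ : ℝ → ℝ} {δ R : ℝ} (hχ : IsCutoff χ δ R)
    (α g : 𝓢(Rn n, ℂ)) (h k : Heis n) :
    𝓕⁻ (leftWave α (fun z => (χ z.2 : ℂ) * 𝓕 g z.1)) (mul (inv k) h) =
      𝓕 (rightWave g (waveCoeff χ (𝓕⁻ α) h)) k := by
  have hd : Integrable fun z : Rn n × ℝ => (χ z.2 : ℂ) * 𝓕 g z.1 :=
    ((𝓕 g).integrable.mul_prod hχ.integrable).congr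
      (Filter.Eventually.of_forall fun z => mul_comm _ _)
  have hc := integrable_waveCoeff hχ (𝓕⁻ α) h
  rw [fourierInv_leftWave α.integrable hd,
    fourier_rightWave g.integrable g.continuous.measurable hc]
  rw [← SchwartzMap.fourierInv_coe, ← SchwartzMap.fourier_coe]
  set β := 𝓕⁻ α
  set γ := 𝓕 g
  have cβ := β.continuous.measurable
  have cγ := γ.continuous.measurable
  have i1 : Integrable fun z : Rn n × ℝ =>
      chi (inner ℝ (yc (mul (inv k) h)) z.1 + tc (mul (inv k) h) * z.2) *
        ((χ z.2 : ℂ) * γ z.1) * β (xc (mul (inv k) h) + z.2⁻¹ • z.1) := by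
    have e := (hd.bdd_mul (c := 1)
      (f := fun z => chi (inner ℝ (yc (mul (inv k) h)) z.1 + tc (mul (inv k) h) * z.2))
      (by fun_prop) (Filter.Eventually.of_forall fun x => by simp)).bdd_mul
      (f := fun z => β (xc (mul (inv k) h) + z.2⁻¹ • z.1))
      (Measurable.aestronglyMeasurable (by fun_prop))
      (Filter.Eventually.of_forall fun x => norm_apply_le_of_schwartz β _)
    exact e.congr (Filter.Eventually.of_forall fun z => mul_comm _ _)
  have i2 : Integrable fun z : Rn n × ℝ => chi (-(inner ℝ (yc k) z.1 + tc k * z.2)) *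
      γ (z.2 • xc k + z.1) * waveCoeff χ β h z := by
    have e := (hc.bdd_mul (f := fun z : Rn n × ℝ => γ (z.2 • xc k + z.1))
      (Measurable.aestronglyMeasurable (by fun_prop))
      (Filter.Eventually.of_forall fun x => norm_apply_le_of_schwartz γ _)).bdd_mul (c := 1)
      (f := fun z => chi (-(inner ℝ (yc k) z.1 + tc k * z.2)))
      (by fun_prop) (Filter.Eventually.of_forall fun x => by simp)
    exact e.congr (Filter.Eventually.of_forall fun z => by simp only [mul_assoc])
  rw [Measure.volume_eq_prod] at i1 i2 ⊢
  rw [integral_prod_symm _ i1, integral_prod_symm _ i2]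
  refine integral_congr_ae ?_
  filter_upwards [Measure.ae_ne volume (0 : ℝ)] with t ht
  symm
  -- At the level `t` the two sides differ by the translation `η ↦ η - t x'`, `k = (x', y', t')`.
  rw [← integral_sub_right_eq_self _ (t • xc k)]
  refine integral_congr_ae (Filter.Eventually.of_forall fun y => ?_)
  simp only [waveCoeff, mul, inv, xc_mk, yc_mk, tc_mk, add_sub_cancel]
  have e1 : xc h + t⁻¹ • (y - t • xc k) = -xc k + xc h + t⁻¹ • y := by
    rw [smul_sub, inv_smul_smul₀ ht]; abel
  have e2 : inner ℝ (-yc k + yc h) y +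
      (-tc k + inner ℝ (xc k) (yc k) + tc h + inner ℝ (-xc k) (yc h)) * t =
      -(inner ℝ (yc k) (y - t • xc k) + tc k * t) +
      (inner ℝ (yc h) (y - t • xc k) + tc h * t) := by
    simp only [inner_sub_right, inner_smul_right, inner_add_left, inner_neg_left,
      real_inner_comm (xc k) (yc k), real_inner_comm (xc k) (yc h)]
    ring
  rw [e1, e2, chi_add (-(inner ℝ (yc k) (y - t • xc k) + tc k * t))]
  ring

/-- A flag kernel acts through its multiplier. -/
theorem apply_eq_integral_of_multiplier {K : 𝓢'(Heis n, ℂ)} {m : Heis n → ℂ}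
    (hm : HasFlagMultiplier K m) (φ : 𝓢(Heis n, ℂ)) : K φ = ∫ ζ, m ζ * (𝓕⁻ φ) ζ := by
  rw [← hm.2 (𝓕⁻ φ), TemperedDistribution.fourier_apply, FourierTransform.fourier_fourierInv_eq]

theorem continuousAt_rightWave {χ : ℝ → ℝ} {δ R : ℝ} (hχ : IsCutoff χ δ R)
    (g b : 𝓢(Rn n, ℂ)) (h ζ : Heis n) (hζ : tc ζ ≠ 0) :
    ContinuousAt (rightWave g (waveCoeff χ b h)) ζ := by
  have c1 := hχ.smooth.continuous
  have cg := g.continuous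
  have cb := b.continuous
  have c2 : ContinuousAt (fun ζ : Heis n => (tc ζ)⁻¹) ζ :=
    continuous_tc.continuousAt.inv₀ hζ
  have c3 : ContinuousAt (fun ζ : Heis n => (|tc ζ| ^ n)⁻¹) ζ :=
    ((continuous_tc.abs.pow n).continuousAt).inv₀ (pow_ne_zero _ (abs_ne_zero.2 hζ))
  unfold rightWave waveCoeff
  refine ContinuousAt.mul (ContinuousAt.mul (ContinuousAt.mul ?_ ?_) ?_)
    (ContinuousAt.mul (ContinuousAt.mul ?_ ?_) ?_)
  · exact Complex.continuous_ofReal.continuousAt.comp c3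
  · exact cg.continuousAt.comp (c2.smul continuous_xc.continuousAt)
  · refine continuous_chi.continuousAt.comp (c2.mul ?_).neg
    fun_prop
  · fun_prop
  · fun_prop
  · exact cb.continuousAt.comp
      (continuousAt_const.add (c2.smul continuous_yc.continuousAt))

/-- The value of a flag kernel on a left translate of a left wave. -/
theorem flag_apply_reflect {K : 𝓢'(Heis n, ℂ)} {m : Heis n → ℂ}
    (hK : HasFlagMultiplier K m) (hm : Measurable m) {M : ℝ} (hM : ∀ ζ, ‖m ζ‖ ≤ M)
    {χ : ℝ → ℝ} {δ R : ℝ} (hχ : IsCutoff χ δ R) (α g : 𝓢(Rn n, ℂ)) {Φ : 𝓢(Heis n, ℂ)}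
    (hΦ : ∀ ζ, Φ ζ = leftWave α (fun z => (χ z.2 : ℂ) * 𝓕 g z.1) ζ) (h : Heis n) :
    K (reflect h (𝓕⁻ Φ)) = ∫ z, quant m g z * waveCoeff χ (𝓕⁻ α) h z := by
  have hΦ' : (Φ : Heis n → ℂ) = leftWave α (fun z => (χ z.2 : ℂ) * 𝓕 g z.1) := funext hΦ
  have e1 : (reflect h (𝓕⁻ Φ) : Heis n → ℂ) =
      𝓕 (rightWave g (waveCoeff χ (𝓕⁻ α) h)) := by
    funext k
    rw [reflect_apply, SchwartzMap.fourierInv_coe, hΦ', fourierInv_leftWave_translate hχ]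
  have hi : Integrable (rightWave g (waveCoeff χ (𝓕⁻ α) h)) :=
    integrable_rightWave g.integrable g.continuous.measurable (integrable_waveCoeff hχ _ h)
  rw [apply_eq_integral_of_multiplier hK, ← integral_mul_rightWave hm hM g.integrable
    g.continuous.measurable (integrable_waveCoeff hχ _ h)]
  refine integral_congr_ae ?_
  filter_upwards [ae_tc_ne (n := n)] with ζ hζ
  rw [SchwartzMap.fourierInv_coe, e1, hi.fourierInv_fourier_eq]
  · rw [← e1]; exact SchwartzMap.integrable _
  · exact continuousAt_rightWave hχ g _ h ζ hζ

/-- Convolution with a flag kernel turns one left wave into another one. -/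
theorem convolution_leftWave {K : 𝓢'(Heis n, ℂ)} {m : Heis n → ℂ}
    (hK : HasFlagMultiplier K m) (hm : Measurable m) {M : ℝ} (hM : ∀ ζ, ‖m ζ‖ ≤ M)
    {χ : ℝ → ℝ} {δ R : ℝ} (hχ : IsCutoff χ δ R) (α g : 𝓢(Rn n, ℂ)) {Φ : 𝓢(Heis n, ℂ)}
    (hΦ : ∀ ζ, Φ ζ = leftWave α (fun z => (χ z.2 : ℂ) * 𝓕 g z.1) ζ)
    (hq : Integrable fun z : Rn n × ℝ => (χ z.2 : ℂ) * quant m g z) (h : Heis n) :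
    convolution K (𝓕⁻ Φ) h = 𝓕⁻ (leftWave α (fun z => (χ z.2 : ℂ) * quant m g z)) h := by
  rw [convolution, flag_apply_reflect hK hm hM hχ α g hΦ, fourierInv_leftWave α.integrable hq,
    ← SchwartzMap.fourierInv_coe]
  refine integral_congr_ae (Filter.Eventually.of_forall fun z => ?_)
  simp only [waveCoeff]; ring

theorem norm_toLp_sq {E : Type*} [MeasurableSpace E] {μ : Measure E} {f : E → ℂ}
    (hf : MemLp f 2 μ) : ‖hf.toLp f‖ ^ 2 = ∫ x, ‖f x‖ ^ 2 ∂μ := by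
  have h := L2.inner_def (𝕜 := ℂ) (hf.toLp f) (hf.toLp f)
  rw [inner_self_eq_norm_sq_to_K] at h
  have h2 : ∫ a, inner ℂ (hf.toLp f a) (hf.toLp f a) ∂μ = ((∫ x, ‖f x‖ ^ 2 ∂μ : ℝ) : ℂ) := by
    refine Eq.trans ?_ (integral_ofReal (𝕜 := ℂ))
    refine integral_congr_ae ?_
    filter_upwards [hf.coeFn_toLp] with x hx
    rw [hx, inner_self_eq_norm_sq_to_K]
    simp
  rw [h2] at h
  apply Complex.ofReal_injective
  rw [← h, Complex.ofReal_pow]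
  rfl

/-- If `G` in `L²` is given by the Fourier integral of an integrable function `w` in `L²`, then `G`
and `w` have the same norm. -/
theorem norm_eq_of_ae_eq_fourierInv {w : Heis n → ℂ} (hw : Integrable w) (hw2 : MemLp w 2)
    (G : L2Heis n) (hG : (G : Heis n → ℂ) =ᵐ[volume] 𝓕⁻ w) :
    ‖G‖ ^ 2 = ∫ ζ, ‖w ζ‖ ^ 2 := by
  have key : 𝓕⁻ (hw2.toLp w) = G := by
    have inj : Function.Injective (Lp.toTemperedDistributionCLM ℂ (volume : Measure (Heis n)) 2) :=
      LinearMap.ker_eq_bot.1 Lp.ker_toTemperedDistributionCLM_eq_bot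
    apply inj
    rw [Lp.toTemperedDistributionCLM_apply, Lp.toTemperedDistributionCLM_apply,
      ← Lp.fourierInv_toTemperedDistribution_eq]
    ext ψ
    rw [TemperedDistribution.fourierInv_apply, Lp.toTemperedDistribution_apply,
      Lp.toTemperedDistribution_apply]
    have h1 : ∫ x, (𝓕⁻ ψ) x • (hw2.toLp w) x = ∫ x, (𝓕⁻ ψ) x • w x := by
      refine integral_congr_ae ?_
      filter_upwards [hw2.coeFn_toLp] with x hx
      rw [hx]
    have h2 : ∫ x, ψ x • G x = ∫ x, ψ x • 𝓕⁻ w x := by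
      refine integral_congr_ae ?_
      filter_upwards [hG] with x hx
      rw [hx]
    rw [h1, h2]
    have h3 := VectorFourier.integral_fourierIntegral_smul_eq_flip (e := Real.fourierChar)
      (L := -innerₗ (Heis n)) (μ := volume) (ν := volume) Real.continuous_fourierChar
      (by simp only [LinearMap.neg_apply, innerₗ_apply_apply]; fun_prop) ψ.integrable hw
    have h4 : (-innerₗ (Heis n)).flip = -innerₗ (Heis n) := by
      ext x y; simp [real_inner_comm]
    rw [h4] at h3
    simp only [SchwartzMap.fourierInv_coe]
    exact h3
  rw [← key, ← norm_toLp_sq hw2]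
  congr 1
  exact (Lp.fourierTransformₗᵢ (Heis n) ℂ).symm.norm_map _

/-! ### Decay and continuity of the symbol operators -/

theorem isOpen_tc_ne : IsOpen {ζ : Heis n | tc ζ ≠ 0} :=
  isOpen_ne_fun continuous_tc continuous_const

/-- The multiplier of a flag kernel may be taken to vanish on `λ = 0`; it is then measurable and
bounded everywhere. -/
theorem IsFlagKernel.exists_multiplier {K : 𝓢'(Heis n, ℂ)} (hK : IsFlagKernel K) :
    ∃ (m : Heis n → ℂ) (M : ℝ), HasFlagMultiplier K m ∧ Measurable m ∧ ∀ ζ, ‖m ζ‖ ≤ M := by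
  classical
  obtain ⟨m, ⟨hs, he⟩, hF⟩ := hK
  let S : Set (Heis n) := {ζ | tc ζ ≠ 0}
  have hmS : MeasurableSet S := isOpen_tc_ne.measurableSet
  have hEq : Set.EqOn (S.piecewise m 0) m S := Set.piecewise_eqOn _ _ _
  obtain ⟨c, hc⟩ := he 0 0 Fin.elim0
  refine ⟨S.piecewise m 0, max c 0, ⟨⟨hs.congr hEq, fun a b j => ?_⟩, fun φ => ?_⟩, ?_, ?_⟩
  · obtain ⟨c, hc⟩ := he a b j
    refine ⟨c, fun ζ hζ => ?_⟩
    rw [(hEq.eventuallyEq_of_mem (isOpen_tc_ne.mem_nhds hζ)).iteratedFDeriv ℝ (a + b) |>.eq_of_nhds]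
    exact hc ζ hζ
  · rw [hF φ]
    refine integral_congr_ae ?_
    filter_upwards [ae_tc_ne (n := n)] with ζ hζ
    rw [hEq hζ]
  · exact hs.continuousOn.measurable_piecewise continuousOn_const hmS
  · intro ζ
    by_cases hζ : tc ζ ≠ 0
    · rw [hEq hζ]
      have h := hc ζ hζ
      rw [pow_zero, pow_zero, mul_one, div_one] at h
      refine le_trans (le_of_eq ?_) (h.trans (le_max_left _ _))
      rfl
    · rw [Set.piecewise_eq_of_notMem _ _ _ hζ]
      simp

theorem norm_multilinear_le_sum_basis {a : ℕ} (T : ContinuousMultilinearMap ℝ (fun _ : Fin a => Rn n) ℂ) :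
    ‖T‖ ≤ ∑ r : Fin a → Fin n, ‖T fun i => EuclideanSpace.single (r i) (1 : ℝ)‖ := by
  classical
  refine T.opNorm_le_bound (Finset.sum_nonneg fun _ _ => norm_nonneg _) fun v => ?_
  have hv : v = fun i => ∑ j, v i j • (EuclideanSpace.single j (1 : ℝ) : Rn n) := by
    funext i
    ext k
    simp [Pi.single_apply]
  have h1 : T v = ∑ r : Fin a → Fin n, (∏ i, v i (r i)) •
      T fun i => EuclideanSpace.single (r i) (1 : ℝ) := by
    conv_lhs => rw [hv]
    rw [T.map_sum]
    refine Finset.sum_congr rfl fun r _ => ?_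
    exact T.map_smul_univ _ _
  rw [h1, Finset.sum_mul]
  refine (norm_sum_le _ _).trans (Finset.sum_le_sum fun r _ => ?_)
  rw [norm_smul, norm_prod, mul_comm]
  gcongr with i
  exact PiLp.norm_apply_le _ _

/-- The embedding `u ↦ (λu, 0, 0)`. -/
def embL (lam : ℝ) : Rn n →L[ℝ] Heis n where
  toFun u := mk (lam • u) 0 0
  map_add' u v := ext_coord (by
    change lam • (u + v) = lam • u + lam • v
    exact smul_add _ _ _) (by change (0 : Rn n) = 0 + 0; simp) (by change (0 : ℝ) = 0 + 0; simp)
  map_smul' r u := ext_coord (by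
    change lam • (r • u) = r • (lam • u)
    exact smul_comm _ _ _) (by change (0 : Rn n) = r • 0; simp) (by change (0 : ℝ) = r • 0; simp)
  cont := by fun_prop

theorem embL_add (lam : ℝ) (u η : Rn n) : embL lam u + mk 0 η lam = mk (lam • u) η lam := by
  apply ext_coord
  · change lam • u + 0 = lam • u
    simp
  · change 0 + η = η
    simp
  · change 0 + lam = lam
    simp

theorem embL_single (lam : ℝ) (i : Fin n) :
    embL lam (EuclideanSpace.single i (1 : ℝ)) =
      lam • (EuclideanSpace.single (Sum.inl (Sum.inl i)) (1 : ℝ) : Heis n) := by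
  ext k
  rcases k with (k | k) | k <;> simp [embL, mk, Pi.single_apply]

/-- The slice `u ↦ m (λu, η, λ)` of a symbol. -/
def slice (m : Heis n → ℂ) (η : Rn n) (lam : ℝ) (u : Rn n) : ℂ := m (mk (lam • u) η lam)

theorem slice_eq (m : Heis n → ℂ) (η : Rn n) (lam : ℝ) :
    slice m η lam = (fun v => m (v + mk 0 η lam)) ∘ embL lam := by
  funext u
  simp [slice, embL_add]

theorem contDiff_slice {m : Heis n → ℂ} (hm : IsFlagMultiplier m) (η : Rn n) {lam : ℝ}
    (hl : lam ≠ 0) : ContDiff ℝ ∞ (slice m η lam) := by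
  have h : ContDiff ℝ ∞ fun u : Rn n => embL lam u + mk 0 η lam :=
    (embL lam).contDiff.add contDiff_const
  have h2 := hm.smooth.comp (s := Set.univ) h.contDiffOn (fun u _ => by
    simp only [embL_add]; exact hl)
  rw [contDiffOn_univ] at h2
  rw [slice_eq]
  exact h2

/-- The derivatives of the slices are bounded, locally uniformly in `λ ≠ 0`. -/
theorem exists_bound_slice {m : Heis n → ℂ} (hm : IsFlagMultiplier m) {δ : ℝ} (hδ : 0 < δ)
    (R : ℝ) (a : ℕ) : ∃ d : ℝ, ∀ (η : Rn n) (lam : ℝ), δ ≤ |lam| → |lam| ≤ R → ∀ u,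
      ‖iteratedFDeriv ℝ a (slice m η lam) u‖ ≤ d := by
  choose c hc using fun r : Fin a → Fin n => hm.estimate a 0 (fun i => Sum.inl (r i))
  refine ⟨∑ r : Fin a → Fin n, R ^ a * (|c r| / √δ ^ a), fun η lam h1 h2 u => ?_⟩
  have hl : lam ≠ 0 := fun h => by simp [h] at h1; linarith
  refine (norm_multilinear_le_sum_basis _).trans (Finset.sum_le_sum fun r _ => ?_)
  let z₀ : Heis n := mk 0 η lam
  let s : Set (Heis n) := {v | tc (v + z₀) ≠ 0}
  have hs : IsOpen s := isOpen_ne_fun (by fun_prop) continuous_const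
  have hpre : embL lam ⁻¹' s = (Set.univ : Set (Rn n)) := by
    ext u
    simp only [s, z₀, Set.mem_preimage, Set.mem_ofPred_eq, embL_add, tc_mk, Set.mem_univ, iff_true]
    exact hl
  have hsm : ContDiffOn ℝ ∞ (fun v => m (v + z₀)) s :=
    hm.smooth.comp (contDiff_id.add contDiff_const).contDiffOn fun v hv => hv
  have hus : embL lam u ∈ s := by
    have : u ∈ embL lam ⁻¹' s := by rw [hpre]; trivial
    exact this
  have key : iteratedFDeriv ℝ a (slice m η lam) u =
      (iteratedFDeriv ℝ a m (mk (lam • u) η lam)).compContinuousLinearMap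
        fun _ => embL lam := by
    have h3 := (embL lam).iteratedFDerivWithin_comp_right hsm hs.uniqueDiffOn
      (by rw [hpre]; exact uniqueDiffOn_univ) hus (i := a) (by exact_mod_cast le_top)
    rw [hpre, iteratedFDerivWithin_univ, iteratedFDerivWithin_of_isOpen a hs hus,
      iteratedFDeriv_comp_add_right, embL_add] at h3
    rw [slice_eq]
    exact h3
  have h4 := hc r (mk (lam • u) η lam) hl
  rw [Fin.append_right_nil _ _ rfl] at h4
  change ‖iteratedFDeriv ℝ a m (mk (lam • u) η lam)
    (fun i => EuclideanSpace.single (Sum.inl (Sum.inl (r i))) (1 : ℝ))‖ ≤ _ at h4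
  rw [key, ContinuousMultilinearMap.compContinuousLinearMap_apply]
  simp only [embL_single]
  rw [ContinuousMultilinearMap.map_smul_univ, norm_smul]
  simp only [Finset.prod_const, Finset.card_univ, Fintype.card_fin, norm_pow, Real.norm_eq_abs]
  refine mul_le_mul (pow_le_pow_left₀ (abs_nonneg _) h2 a) ?_ (norm_nonneg _)
    (pow_nonneg ((abs_nonneg lam).trans h2) a)
  refine h4.trans ?_
  rw [pow_zero, mul_one, tc_mk]
  have h5 : √δ ≤ (∑ i, |(mk (lam • u) η lam) (Sum.inl i)|) + √|lam| :=
    (Real.sqrt_le_sqrt h1).trans (le_add_of_nonneg_left (Finset.sum_nonneg fun _ _ => abs_nonneg _))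
  have h6 : 0 < √δ := Real.sqrt_pos.2 hδ
  exact div_le_div₀ (abs_nonneg _) (le_abs_self _) (by positivity)
    (pow_le_pow_left₀ h6.le h5 a)

/-- The Fourier transform of a Schwartz function times a function with bounded derivatives is
rapidly decreasing, with constants that depend only on the bounds of the derivatives. -/
theorem exists_fourier_mul_decay (g : 𝓢(Rn n, ℂ)) (d : ℕ → ℝ) (N : ℕ) :
    ∃ C : ℝ, ∀ f : Rn n → ℂ, ContDiff ℝ ∞ f → (∀ i u, ‖iteratedFDeriv ℝ i f u‖ ≤ d i) →
      ∀ η, ‖η‖ ^ N * ‖𝓕 (fun u => f u * g u) η‖ ≤ C := by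
  let B (p : ℕ) (u : Rn n) : ℝ :=
    ∑ i ∈ Finset.range (p + 1), (p.choose i : ℝ) * d i * ‖iteratedFDeriv ℝ (p - i) g u‖
  have hB : ∀ p, Integrable (B p) := fun p => integrable_finsetSum _ fun i _ =>
    (by simpa using g.integrable_pow_mul_iteratedFDeriv volume 0 (p - i) :
      Integrable fun u => ‖iteratedFDeriv ℝ (p - i) g u‖).const_mul _
  refine ⟨2 ^ N * ∑ p ∈ Finset.range (0 + 1) ×ˢ Finset.range (N + 1), ∫ u, B p.2 u,
    fun f hf hd η => ?_⟩
  have hfg : ContDiff ℝ ∞ fun u => f u * g u := hf.mul (g.smooth ⊤)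
  have hle : ∀ p u, ‖iteratedFDeriv ℝ p (fun u => f u * g u) u‖ ≤ B p u := fun p u => by
    refine (norm_iteratedFDeriv_mul_le (n := p) hf (g.smooth ⊤) u
      (by exact_mod_cast le_top)).trans (Finset.sum_le_sum fun i _ => ?_)
    gcongr
    exact hd i u
  have hint : ∀ p, Integrable fun u => ‖iteratedFDeriv ℝ p (fun u => f u * g u) u‖ := fun p =>
    (hB p).mono' (hfg.continuous_iteratedFDeriv (by exact_mod_cast le_top)).norm.aestronglyMeasurable
      (Filter.Eventually.of_forall fun u => by simpa using hle p u)
  have h := Real.pow_mul_norm_iteratedFDeriv_fourier_le (K := 0) (N := ⊤) (k := 0) (n := N) hfg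
    (fun k p hk _ => by
      have : k = 0 := by simpa using hk
      simpa [this] using hint p) le_rfl (by exact_mod_cast le_top) η
  rw [norm_iteratedFDeriv_zero] at h
  refine h.trans ?_
  have e : (2 * Real.pi) ^ 0 * (2 * ((0 : ℕ) : ℝ) + 2) ^ N = 2 ^ N := by simp
  rw [e]
  refine mul_le_mul_of_nonneg_left (Finset.sum_le_sum fun p hp => ?_) (by positivity)
  have hp0 : p.1 = 0 := by simpa using (Finset.mem_product.1 hp).1
  simp only [hp0, pow_zero, one_mul]
  exact integral_mono (hint p.2) (hB p.2) (hle p.2)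

theorem quant_eq_fourier (m : Heis n → ℂ) (g : Rn n → ℂ) (η : Rn n) (lam : ℝ) :
    quant m g (η, lam) = 𝓕 (fun u => slice m η lam u * g u) η := by
  rw [quant, fourier_eq_chi]
  refine integral_congr_ae (Filter.Eventually.of_forall fun u => ?_)
  simp only [slice]; ring

/-- `quant m g` decays rapidly in `η`, locally uniformly in `λ ≠ 0`. -/
theorem exists_quant_decay {m : Heis n → ℂ} (hm : IsFlagMultiplier m) (g : 𝓢(Rn n, ℂ))
    {δ : ℝ} (hδ : 0 < δ) (R : ℝ) :
    ∃ C : ℝ, 0 ≤ C ∧ ∀ (η : Rn n) (lam : ℝ), δ ≤ |lam| → |lam| ≤ R →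
      ‖quant m g (η, lam)‖ ≤ C * (1 + ‖η‖) ^ (-(n + 1 : ℝ)) := by
  choose d hd using exists_bound_slice hm hδ R
  obtain ⟨C₀, h₀⟩ := exists_fourier_mul_decay g d 0
  obtain ⟨C₁, h₁⟩ := exists_fourier_mul_decay g d (n + 1)
  refine ⟨2 ^ n * (|C₀| + |C₁|), by positivity, fun η lam h1 h2 => ?_⟩
  have hl : lam ≠ 0 := fun h => by simp [h] at h1; linarith
  have a₀ := h₀ _ (contDiff_slice hm η hl) (fun i u => hd i η lam h1 h2 u) η
  have a₁ := h₁ _ (contDiff_slice hm η hl) (fun i u => hd i η lam h1 h2 u) η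
  rw [← quant_eq_fourier] at a₀ a₁
  rw [pow_zero, one_mul] at a₀
  have e : (1 + ‖η‖) ^ (-(n + 1 : ℝ)) = ((1 + ‖η‖) ^ (n + 1))⁻¹ := by
    rw [Real.rpow_neg (by positivity), ← Nat.cast_add_one, Real.rpow_natCast]
  rw [e, ← div_eq_mul_inv, le_div_iff₀ (by positivity)]
  have h3 : (1 + ‖η‖) ^ (n + 1) ≤ 2 ^ n * (1 + ‖η‖ ^ (n + 1)) := by
    simpa using add_pow_le zero_le_one (norm_nonneg η) (n + 1)
  calc ‖quant m g (η, lam)‖ * (1 + ‖η‖) ^ (n + 1)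
      ≤ ‖quant m g (η, lam)‖ * (2 ^ n * (1 + ‖η‖ ^ (n + 1))) := by gcongr
    _ = 2 ^ n * (‖quant m g (η, lam)‖ + ‖η‖ ^ (n + 1) * ‖quant m g (η, lam)‖) := by ring
    _ ≤ 2 ^ n * (|C₀| + |C₁|) := by
      gcongr
      · exact a₀.trans (le_abs_self _)
      · exact a₁.trans (le_abs_self _)

theorem integrable_decay : Integrable fun η : Rn n => (1 + ‖η‖) ^ (-(n + 1 : ℝ)) :=
  integrable_one_add_norm (by simp)

theorem decay_sq_le (C : ℝ) (η : Rn n) :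
    (C * (1 + ‖η‖) ^ (-(n + 1 : ℝ))) ^ 2 ≤ C ^ 2 * (1 + ‖η‖) ^ (-(n + 1 : ℝ)) := by
  have h1 : (1 + ‖η‖) ^ (-(n + 1 : ℝ)) ≤ 1 :=
    Real.rpow_le_one_of_one_le_of_nonpos (by linarith [norm_nonneg η]) (by linarith [n.cast_nonneg (α := ℝ)])
  have h0 : 0 ≤ (1 + ‖η‖) ^ (-(n + 1 : ℝ)) := by positivity
  rw [mul_pow]
  gcongr
  nlinarith

theorem stronglyMeasurable_quant {m : Heis n → ℂ} (hm : Measurable m) {g : Rn n → ℂ}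
    (hg : Measurable g) : StronglyMeasurable (quant m g) := by
  unfold quant
  refine StronglyMeasurable.integral_prod_right (f := fun (z : Rn n × ℝ) u =>
    m (mk (z.2 • u) z.1 z.2) * chi (-inner ℝ u z.1) * g u) ?_
  exact Measurable.stronglyMeasurable (by fun_prop)

theorem continuousAt_flag {m : Heis n → ℂ} (hm : IsFlagMultiplier m) {ζ : Heis n}
    (hζ : tc ζ ≠ 0) : ContinuousAt m ζ :=
  hm.smooth.continuousOn.continuousAt (isOpen_tc_ne.mem_nhds hζ)

theorem continuousAt_quant {m : Heis n → ℂ} (hf : IsFlagMultiplier m) (hm : Measurable m)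
    {M : ℝ} (hM : ∀ ζ, ‖m ζ‖ ≤ M) {g : Rn n → ℂ} (hg : Integrable g) (hgm : Measurable g)
    (η : Rn n) {lam : ℝ} (hl : lam ≠ 0) :
    ContinuousAt (fun t => quant m g (η, t)) lam := by
  unfold quant
  refine continuousAt_of_dominated (bound := fun u => M * ‖g u‖) ?_ ?_ (hg.norm.const_mul M) ?_
  · exact Filter.Eventually.of_forall fun t => Measurable.aestronglyMeasurable (by fun_prop)
  · refine Filter.Eventually.of_forall fun t => Filter.Eventually.of_forall fun u => ?_
    rw [norm_mul, norm_mul, norm_chi, mul_one]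
    gcongr
    exact hM _
  · refine Filter.Eventually.of_forall fun u => ?_
    have h1 : ContinuousAt (fun t : ℝ => m (mk (t • u) η t)) lam :=
      ContinuousAt.comp (g := m) (f := fun t : ℝ => mk (t • u) η t)
        (continuousAt_flag hf hl) (by fun_prop)
    exact (h1.mul_const (chi (-inner ℝ u η))).mul_const (g u)

/-- The square norm of `quant m g` at the level `λ` is a continuous function of `λ ≠ 0`. -/
theorem continuousAt_integral_quant_sq {m : Heis n → ℂ} (hf : IsFlagMultiplier m)
    (hm : Measurable m) {M : ℝ} (hM : ∀ ζ, ‖m ζ‖ ≤ M) (g : 𝓢(Rn n, ℂ)) {lam : ℝ}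
    (hl : lam ≠ 0) : ContinuousAt (fun t => ∫ η, ‖quant m g (η, t)‖ ^ 2) lam := by
  have hp : 0 < |lam| := abs_pos.2 hl
  obtain ⟨C, hC0, hC⟩ := exists_quant_decay hf g (half_pos hp) (2 * |lam|)
  have hgm := g.continuous.measurable
  have hq := stronglyMeasurable_quant hm hgm
  refine continuousAt_of_dominated
    (bound := fun η => C ^ 2 * (1 + ‖η‖) ^ (-(n + 1 : ℝ))) ?_ ?_ (integrable_decay.const_mul _) ?_
  · refine Filter.Eventually.of_forall fun t => ?_
    have := hq.comp_measurable (measurable_prodMk_right (y := t) (α := Rn n))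
    exact (this.aestronglyMeasurable.norm).pow 2
  · have h1 : ∀ᶠ t in nhds lam, |lam| / 2 < |t| :=
      continuous_abs.continuousAt.eventually_const_lt (by linarith)
    have h2 : ∀ᶠ t in nhds lam, |t| < 2 * |lam| :=
      continuous_abs.continuousAt.eventually_lt_const (by linarith)
    filter_upwards [h1, h2] with t h1 h2
    refine Filter.Eventually.of_forall fun η => ?_
    rw [norm_pow, norm_norm]
    exact (pow_le_pow_left₀ (norm_nonneg _) (hC η t h1.le h2.le) 2).trans (decay_sq_le C η)
  · refine Filter.Eventually.of_forall fun η => ?_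
    exact (continuousAt_quant hf hm hM g.integrable hgm η hl).norm.pow 2

theorem integrable_cutoff_quant {m : Heis n → ℂ} (hf : IsFlagMultiplier m)
    (hm : Measurable m) (g : 𝓢(Rn n, ℂ)) {χ : ℝ → ℝ} {δ R : ℝ} (hχ : IsCutoff χ δ R) :
    (Integrable fun z : Rn n × ℝ => (χ z.2 : ℂ) * quant m g z) ∧
      MemLp (fun z : Rn n × ℝ => (χ z.2 : ℂ) * quant m g z) 2 := by
  obtain ⟨C, hC0, hC⟩ := exists_quant_decay hf g hχ.pos R
  have hgm := g.continuous.measurable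
  have c1 := hχ.smooth.continuous
  have hq := stronglyMeasurable_quant hm hgm
  have hχm : AEStronglyMeasurable fun z : Rn n × ℝ => (χ z.2 : ℂ) :=
    Continuous.aestronglyMeasurable (by fun_prop)
  have hm : AEStronglyMeasurable fun z : Rn n × ℝ => (χ z.2 : ℂ) * quant m g z :=
    hχm.mul hq.aestronglyMeasurable
  have hb : ∀ z : Rn n × ℝ, ‖(χ z.2 : ℂ) * quant m g z‖ ≤
      |χ z.2| * (C * (1 + ‖z.1‖) ^ (-(n + 1 : ℝ))) := fun z => by
    rw [norm_mul, Complex.norm_real, Real.norm_eq_abs]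
    by_cases h0 : χ z.2 = 0
    · simp [h0]
    · gcongr
      exact hC z.1 z.2 (hχ.bounds _ h0).1 (hχ.bounds _ h0).2
  constructor
  · refine Integrable.mono' ?_ hm (Filter.Eventually.of_forall hb)
    refine (((integrable_decay (n := n)).const_mul C).mul_prod
      (ν := volume) (g := fun t => |χ t|) ?_).congr
      (Filter.Eventually.of_forall fun z => mul_comm _ _)
    exact (c1.abs).integrable_of_hasCompactSupport
      (hχ.hasCompactSupport.comp_left (g := fun r => |r|) abs_zero)
  · rw [memLp_two_iff_integrable_sq_norm hm]
    have hs : HasCompactSupport fun t => χ t ^ 2 := by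
      simp only [sq]
      exact hχ.hasCompactSupport.mul_left
    have hi : Integrable fun t => χ t ^ 2 :=
      Continuous.integrable_of_hasCompactSupport (by fun_prop) hs
    have hi2 : Integrable fun z : Rn n × ℝ =>
        (C ^ 2 * (1 + ‖z.1‖) ^ (-(n + 1 : ℝ))) * χ z.2 ^ 2 :=
      ((integrable_decay (n := n)).const_mul (C ^ 2)).mul_prod hi
    have hm2 := hm.norm.pow 2
    refine hi2.mono' hm2 (Filter.Eventually.of_forall fun z => ?_)
    rw [norm_pow, norm_norm]
    refine (pow_le_pow_left₀ (norm_nonneg _) (hb z) 2).trans ?_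
    rw [mul_pow, sq_abs, mul_comm]
    gcongr
    exact decay_sq_le C z.1

/-! ### Bounds at a single level -/

theorem IsCutoff.integrable_smul {E : Type*} [NormedAddCommGroup E] [NormedSpace ℝ E]
    {χ : ℝ → ℝ} {δ R : ℝ} (h : IsCutoff χ δ R) {w : ℝ → E} (hw : ContinuousOn w {t | t ≠ 0}) :
    Integrable fun t => χ t • w t := by
  let S : Set ℝ := {t | δ ≤ |t|} ∩ Metric.closedBall 0 R
  have hS : IsCompact S :=
    (isCompact_closedBall (0 : ℝ) R).inter_left (isClosed_le continuous_const continuous_abs)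
  have hsub : S ⊆ {t | t ≠ 0} := fun t ht h0 => by
    have : δ ≤ |t| := ht.1
    rw [h0, abs_zero] at this
    linarith [h.pos]
  have hc : ContinuousOn (fun t => χ t • w t) S :=
    h.smooth.continuous.continuousOn.smul (hw.mono hsub)
  refine (integrableOn_iff_integrable_of_support_subset fun t ht => ?_).1
    (hc.integrableOn_compact hS)
  have h0 : χ t ≠ 0 := fun h0 => ht (by simp [h0])
  exact ⟨(h.bounds t h0).1, by simpa using (h.bounds t h0).2⟩

theorem IsCutoff.sq {χ : ℝ → ℝ} {δ R : ℝ} (h : IsCutoff χ δ R) :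
    IsCutoff (fun t => χ t ^ 2) δ R :=
  ⟨h.smooth.pow 2, h.pos, fun t ht => h.bounds t fun h0 => ht (by simp [h0])⟩

/-- A function of `λ ≠ 0` that is continuous and nonnegative on average against all squares of
cutoff functions is nonnegative. -/
theorem nonneg_of_cutoff {w : ℝ → ℝ} (hw : ContinuousOn w {t | t ≠ 0})
    (h : ∀ (χ : ℝ → ℝ) (δ R : ℝ), IsCutoff χ δ R → 0 ≤ ∫ t, χ t ^ 2 * w t)
    {lam : ℝ} (hl : lam ≠ 0) : 0 ≤ w lam := by
  by_contra! hneg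
  have hp : 0 < |lam| := abs_pos.2 hl
  have hc : ContinuousAt w lam := hw.continuousAt (isOpen_ne.mem_nhds hl)
  have h1 : ∀ᶠ t in nhds lam, w t < w lam / 2 := hc.eventually_lt_const (by linarith)
  obtain ⟨r, hr0, hr⟩ := Metric.eventually_nhds_iff_ball.1 h1
  let ρ := min r (|lam| / 2)
  have hρ : 0 < ρ := lt_min hr0 (by linarith)
  let b : ContDiffBump lam := ⟨ρ / 2, ρ, by linarith, by linarith⟩
  have hbs : ∀ t, b t ≠ 0 → t ∈ Metric.ball lam ρ := fun t ht => by
    have : t ∈ Function.support b := ht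
    rwa [b.support_eq] at this
  have hcut : IsCutoff b (|lam| / 2) (2 * |lam|) := by
    refine ⟨b.contDiff, by linarith, fun t ht => ?_⟩
    have h2 : |t - lam| < |lam| / 2 := by
      have := hbs t ht
      rw [Metric.mem_ball, Real.dist_eq] at this
      exact this.trans_le (min_le_right _ _)
    have h3 := abs_sub_abs_le_abs_sub lam t
    have h4 := abs_sub_abs_le_abs_sub t lam
    rw [abs_sub_comm lam t] at h3
    constructor <;> linarith
  have i1 : Integrable fun t => b t ^ 2 * w t := hcut.sq.integrable_smul hw
  have i2 : Integrable fun t => b t ^ 2 * (w lam / 2) :=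
    hcut.sq.integrable_smul (w := fun _ => w lam / 2) continuousOn_const
  have hle : ∫ t, b t ^ 2 * w t ≤ ∫ t, b t ^ 2 * (w lam / 2) := by
    refine integral_mono i1 i2 fun t => ?_
    by_cases h0 : b t = 0
    · simp [h0]
    · refine mul_le_mul_of_nonneg_left (hr t ?_).le (by positivity)
      exact Metric.ball_subset_ball (min_le_left _ _) (hbs t h0)
  have hpos : 0 < ∫ t, b t ^ 2 := by
    refine Continuous.integral_pos_of_hasCompactSupport_nonneg_nonzero (x := lam)
      (b.continuous.pow 2) hcut.sq.hasCompactSupport (fun t => by positivity) ?_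
    have : b lam = 1 := b.one_of_mem_closedBall (Metric.mem_closedBall_self (by positivity))
    simp [this]
  rw [integral_mul_const] at hle
  have := h b _ _ hcut
  nlinarith

theorem eq_zero_of_cutoff {w : ℝ → ℂ} (hw : ContinuousOn w {t | t ≠ 0})
    (h : ∀ (χ : ℝ → ℝ) (δ R : ℝ), IsCutoff χ δ R → ∫ t, χ t • w t = 0)
    {lam : ℝ} (hl : lam ≠ 0) : w lam = 0 := by
  have key : ∀ L : ℂ →L[ℝ] ℝ, 0 ≤ L (w lam) := fun L => by
    refine nonneg_of_cutoff (w := fun t => L (w t)) (L.continuous.comp_continuousOn hw)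
      (fun χ δ R hχ => le_of_eq ?_) hl
    have e := L.integral_comp_comm (hχ.sq.integrable_smul hw)
    rw [h _ _ _ hχ.sq, map_zero] at e
    simp only [map_smul, smul_eq_mul] at e
    exact e.symm
  have h1 := key Complex.reCLM
  have h2 := key (-Complex.reCLM)
  have h3 := key Complex.imCLM
  have h4 := key (-Complex.imCLM)
  simp only [neg_apply, Complex.reCLM_apply, Complex.imCLM_apply] at h1 h2 h3 h4
  exact Complex.ext (by simp; linarith) (by simp; linarith)

theorem norm_schwartz_sq {E : Type*} [NormedAddCommGroup E] [InnerProductSpace ℝ E]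
    [FiniteDimensional ℝ E] [MeasurableSpace E] [BorelSpace E] (f : 𝓢(E, ℂ)) :
    ‖f.toLp 2 volume‖ ^ 2 = ∫ x, ‖f x‖ ^ 2 :=
  norm_toLp_sq (f.memLp 2 volume)

theorem integral_cutoff_quant_sq {m : Heis n → ℂ} (hf : IsFlagMultiplier m)
    (hm : Measurable m) (g : 𝓢(Rn n, ℂ)) {χ : ℝ → ℝ} {δ R : ℝ} (hχ : IsCutoff χ δ R) :
    ∫ z : Rn n × ℝ, ‖(χ z.2 : ℂ) * quant m g z‖ ^ 2 =
      ∫ t, χ t ^ 2 * ∫ η, ‖quant m g (η, t)‖ ^ 2 := by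
  have h := (integrable_cutoff_quant hf hm g hχ).2
  rw [memLp_two_iff_integrable_sq_norm h.aestronglyMeasurable, Measure.volume_eq_prod] at h
  rw [Measure.volume_eq_prod, integral_prod_symm _ h]
  refine integral_congr_ae (Filter.Eventually.of_forall fun t => ?_)
  simp only [norm_mul, mul_pow, Complex.norm_real, Real.norm_eq_abs, sq_abs]
  rw [integral_const_mul]

theorem integral_cutoff_mul_sq (γ : Rn n → ℂ) (χ : ℝ → ℝ) :
    ∫ z : Rn n × ℝ, ‖(χ z.2 : ℂ) * γ z.1‖ ^ 2 = (∫ t, χ t ^ 2) * ∫ η, ‖γ η‖ ^ 2 := by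
  rw [mul_comm, ← integral_prod_mul, ← Measure.volume_eq_prod]
  refine integral_congr_ae (Filter.Eventually.of_forall fun z => ?_)
  simp [mul_pow, mul_comm]

theorem exists_schwartz_norm_pos (n : ℕ) : ∃ α : 𝓢(Rn n, ℂ), 0 < ∫ x, ‖α x‖ ^ 2 := by
  let b : ContDiffBump (0 : Rn n) := ⟨1, 2, by norm_num, by norm_num⟩
  have hc : HasCompactSupport fun x => (b x : ℂ) :=
    b.hasCompactSupport.comp_left (g := fun r : ℝ => (r : ℂ)) (by simp)
  refine ⟨hc.toSchwartzMap (Complex.ofRealCLM.contDiff.comp b.contDiff), ?_⟩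
  have e : ∀ x, ‖hc.toSchwartzMap (Complex.ofRealCLM.contDiff.comp b.contDiff) x‖ ^ 2 =
      b x * b x := fun x => by
    change ‖(b x : ℂ)‖ ^ 2 = _
    rw [Complex.norm_real, Real.norm_eq_abs, sq_abs, pow_two]
  simp only [e]
  refine Continuous.integral_pos_of_hasCompactSupport_nonneg_nonzero (x := 0)
    (b.continuous.mul b.continuous) b.hasCompactSupport.mul_left
    (fun t => mul_self_nonneg _) ?_
  have : b 0 = 1 := b.one_of_mem_closedBall (Metric.mem_closedBall_self (by norm_num))
  simp [this]

/-- The operator norms of `Op(K)` and of its inverse bound the symbol operators at every level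
`λ ≠ 0` from both sides. -/
theorem quant_bounds {K : 𝓢'(Heis n, ℂ)} {m : Heis n → ℂ}
    (hK : HasFlagMultiplier K m) (hm : Measurable m) {M : ℝ} (hM : ∀ ζ, ‖m ζ‖ ≤ M)
    (A : L2Heis n ≃L[ℂ] L2Heis n) (hA : IsOp K (A : L2Heis n →L[ℂ] L2Heis n))
    (g : 𝓢(Rn n, ℂ)) {lam : ℝ} (hl : lam ≠ 0) :
    (∫ η, ‖quant m g (η, lam)‖ ^ 2 ≤
      ‖(A : L2Heis n →L[ℂ] L2Heis n)‖ ^ 2 * ∫ u, ‖g u‖ ^ 2) ∧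
    (∫ u, ‖g u‖ ^ 2 ≤
      ‖(A.symm : L2Heis n →L[ℂ] L2Heis n)‖ ^ 2 * ∫ η, ‖quant m g (η, lam)‖ ^ 2) := by
  obtain ⟨α, hα⟩ := exists_schwartz_norm_pos n
  set G := ∫ u, ‖g u‖ ^ 2 with hG
  have hGγ : ∫ η, ‖𝓕 g η‖ ^ 2 = G := SchwartzMap.integral_norm_sq_fourier g
  set N : ℝ → ℝ := fun t => ∫ η, ‖quant m g (η, t)‖ ^ 2 with hN
  have hNc : ContinuousOn N {t | t ≠ 0} := fun t ht =>
    (continuousAt_integral_quant_sq hK.1 hm hM g ht).continuousWithinAt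
  -- Plancherel's theorem for the wave packet given by `α`, `g` and `χ`; the factor `‖α‖²` cancels.
  have key : ∀ (χ : ℝ → ℝ) (δ R : ℝ), IsCutoff χ δ R →
      (∫ t, χ t ^ 2 * N t) ≤ ‖(A : L2Heis n →L[ℂ] L2Heis n)‖ ^ 2 * ((∫ t, χ t ^ 2) * G) ∧
      ((∫ t, χ t ^ 2) * G) ≤
        ‖(A.symm : L2Heis n →L[ℂ] L2Heis n)‖ ^ 2 * ∫ t, χ t ^ 2 * N t := by
    intro χ δ R hχ
    obtain ⟨Φ, hΦ⟩ := exists_schwartz_leftWave α (𝓕 g) hχ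
    obtain ⟨hq1, hq2⟩ := integrable_cutoff_quant hK.1 hm g hχ
    set F := (𝓕⁻ Φ).toLp 2 volume
    have n1 : ‖F‖ ^ 2 = (∫ x, ‖α x‖ ^ 2) * ((∫ t, χ t ^ 2) * G) := by
      have e : ‖F‖ = ‖Φ.toLp 2 volume‖ := by
        rw [← SchwartzMap.norm_fourier_toL2_eq (𝓕⁻ Φ), FourierTransform.fourier_fourierInv_eq]
      rw [e, norm_schwartz_sq]
      simp only [hΦ]
      rw [integral_norm_sq_leftWave, integral_cutoff_mul_sq, hGγ]
    have n2 : ‖A F‖ ^ 2 = (∫ x, ‖α x‖ ^ 2) * ∫ t, χ t ^ 2 * N t := by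
      rw [norm_eq_of_ae_eq_fourierInv (integrable_leftWave α.integrable hq1)
        (memLp_leftWave (α.memLp 2 volume) hq2) (A F),
        integral_norm_sq_leftWave, integral_cutoff_quant_sq hK.1 hm g hχ]
      refine (hA (𝓕⁻ Φ)).trans (Filter.Eventually.of_forall fun h => ?_)
      exact convolution_leftWave hK hm hM hχ α g hΦ hq1 h
    have b1 : ‖A F‖ ≤ ‖(A : L2Heis n →L[ℂ] L2Heis n)‖ * ‖F‖ :=
      (A : L2Heis n →L[ℂ] L2Heis n).le_opNorm F
    have b2 : ‖F‖ ≤ ‖(A.symm : L2Heis n →L[ℂ] L2Heis n)‖ * ‖A F‖ := by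
      simpa using (A.symm : L2Heis n →L[ℂ] L2Heis n).le_opNorm (A F)
    have c1 := pow_le_pow_left₀ (norm_nonneg _) b1 2
    have c2 := pow_le_pow_left₀ (norm_nonneg _) b2 2
    rw [mul_pow, n1, n2] at c1 c2
    constructor
    · refine le_of_mul_le_mul_left ?_ hα
      linarith
    · refine le_of_mul_le_mul_left ?_ hα
      linarith
  have i2 : ∀ {χ : ℝ → ℝ} {δ R : ℝ}, IsCutoff χ δ R → ∀ c : ℝ,
      Integrable fun t => χ t ^ 2 * c := fun h c =>
    h.sq.integrable_smul (w := fun _ => c) continuousOn_const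
  have i3 : ∀ {χ : ℝ → ℝ} {δ R : ℝ}, IsCutoff χ δ R →
      Integrable fun t => χ t ^ 2 * N t := fun h => h.sq.integrable_smul hNc
  constructor
  · have := nonneg_of_cutoff
      (w := fun t => ‖(A : L2Heis n →L[ℂ] L2Heis n)‖ ^ 2 * G - N t)
      (continuousOn_const.sub hNc) (fun χ δ R hχ => ?_) hl
    · exact sub_nonneg.1 this
    · have e := (key χ δ R hχ).1
      simp only [mul_sub]
      rw [integral_sub (i2 hχ _) (i3 hχ), integral_mul_const]
      linarith
  · have := nonneg_of_cutoff
      (w := fun t => ‖(A.symm : L2Heis n →L[ℂ] L2Heis n)‖ ^ 2 * N t - G)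
      ((continuousOn_const.mul hNc).sub continuousOn_const) (fun χ δ R hχ => ?_) hl
    · exact sub_nonneg.1 this
    · have e := (key χ δ R hχ).2
      simp only [mul_sub, mul_left_comm _ (‖(A.symm : L2Heis n →L[ℂ] L2Heis n)‖ ^ 2)]
      rw [integral_sub ((i3 hχ).const_mul _) (i2 hχ _), integral_mul_const, integral_const_mul]
      linarith

/-! ### Symmetry at a single level -/

theorem inv_inv' (h : Heis n) : inv (inv h) = h := by
  apply ext_coord <;> simp [inv]

theorem involution_reflect_zero (F : 𝓢(Heis n, ℂ)) (h : Heis n) :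
    involution (reflect 0 F) h = conj (F h) := by
  rw [involution_apply, reflect_apply, inv_inv', mul_zero']

theorem exists_schwartz_scale (f : 𝓢(Rn n, ℂ)) {r : ℝ} (hr : r ≠ 0) :
    ∃ g : 𝓢(Rn n, ℂ), ∀ x, g x = f (r • x) :=
  ⟨SchwartzMap.compCLMOfContinuousLinearEquiv ℂ
    (ContinuousLinearEquiv.smulLeft (R₁ := ℝ) (M₁ := Rn n) (Units.mk0 r hr)) f, fun _ => rfl⟩

theorem exists_schwartz_conj (f : 𝓢(Rn n, ℂ)) :
    ∃ g : 𝓢(Rn n, ℂ), ∀ x, g x = conj (f x) :=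
  ⟨SchwartzMap.postcompCLM (𝕜 := ℝ) (Complex.conjCLE : ℂ →L[ℝ] ℂ) f, fun _ => rfl⟩

/-- The form `∫∫ m (ξ, η, t) e^{-2πi ξη/t} conj a(ξ) conj c(η) dξ dη`. -/
def symbolForm (m : Heis n → ℂ) (a c : 𝓢(Rn n, ℂ)) (t : ℝ) : ℂ :=
  ∫ p : Rn n × Rn n, m (mk p.1 p.2 t) * chi (-(t⁻¹ * inner ℝ p.1 p.2)) *
    (conj (a p.1) * conj (c p.2))

theorem integrable_conj_mul_conj (a c : 𝓢(Rn n, ℂ)) :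
    Integrable fun p : Rn n × Rn n => conj (a p.1) * conj (c p.2) := by
  have h := a.integrable.mul_prod c.integrable (μ := volume) (ν := volume)
  refine ((Complex.conjCLE : ℂ →L[ℝ] ℂ).integrable_comp h).congr
    (Filter.Eventually.of_forall fun p => ?_)
  simp

theorem integrable_symbolForm {m : Heis n → ℂ} (hm : Measurable m) {M : ℝ}
    (hM : ∀ ζ, ‖m ζ‖ ≤ M) (a c : 𝓢(Rn n, ℂ)) (t : ℝ) :
    Integrable fun p : Rn n × Rn n => m (mk p.1 p.2 t) * chi (-(t⁻¹ * inner ℝ p.1 p.2)) *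
      (conj (a p.1) * conj (c p.2)) := by
  refine (integrable_conj_mul_conj a c).bdd_mul (c := M)
    (Measurable.aestronglyMeasurable (by fun_prop)) (Filter.Eventually.of_forall fun p => ?_)
  rw [norm_mul, norm_chi, mul_one]
  exact hM _

theorem continuousAt_symbolForm {m : Heis n → ℂ} (hf : IsFlagMultiplier m) (hm : Measurable m)
    {M : ℝ} (hM : ∀ ζ, ‖m ζ‖ ≤ M) (a c : 𝓢(Rn n, ℂ)) {lam : ℝ} (hl : lam ≠ 0) :
    ContinuousAt (symbolForm m a c) lam := by
  unfold symbolForm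
  refine continuousAt_of_dominated
    (bound := fun p => M * ‖conj (a p.1) * conj (c p.2)‖) ?_ ?_
    ((integrable_conj_mul_conj a c).norm.const_mul M) ?_
  · exact Filter.Eventually.of_forall fun t =>
      (integrable_symbolForm hm hM a c t).aestronglyMeasurable
  · refine Filter.Eventually.of_forall fun t => Filter.Eventually.of_forall fun p => ?_
    rw [norm_mul, norm_mul (m _), norm_chi, mul_one]
    gcongr
    exact hM _
  · refine Filter.Eventually.of_forall fun p => ?_
    have h1 : ContinuousAt (fun t : ℝ => m (mk p.1 p.2 t)) lam :=
      ContinuousAt.comp (g := m) (f := fun t : ℝ => mk p.1 p.2 t)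
        (continuousAt_flag hf hl) (by fun_prop)
    have h2 : ContinuousAt (fun t : ℝ => chi (-(t⁻¹ * inner ℝ p.1 p.2))) lam :=
      continuous_chi.continuousAt.comp ((continuousAt_inv₀ hl).mul_const _).neg
    exact (h1.mul h2).mul_const _

theorem norm_quant_le {m : Heis n → ℂ} {M : ℝ} (hM : ∀ ζ, ‖m ζ‖ ≤ M) {g : Rn n → ℂ}
    (hg : Integrable g) (z : Rn n × ℝ) : ‖quant m g z‖ ≤ M * ∫ u, ‖g u‖ := by
  rw [← integral_const_mul]
  refine norm_integral_le_of_norm_le (hg.norm.const_mul M)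
    (Filter.Eventually.of_forall fun u => ?_)
  rw [norm_mul, norm_mul, norm_chi, mul_one]
  gcongr
  exact hM _

theorem continuousAt_integral_quant_mul {m : Heis n → ℂ} (hf : IsFlagMultiplier m)
    (hm : Measurable m) {M : ℝ} (hM : ∀ ζ, ‖m ζ‖ ≤ M) (g b : 𝓢(Rn n, ℂ)) {lam : ℝ}
    (hl : lam ≠ 0) : ContinuousAt (fun t => ∫ η, quant m g (η, t) * b (t⁻¹ • η)) lam := by
  have hp : 0 < |lam| := abs_pos.2 hl
  obtain ⟨C, hC0, hC⟩ := exists_quant_decay hf g (half_pos hp) (2 * |lam|)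
  have hgm := g.continuous.measurable
  have hbm := b.continuous.measurable
  have hq := stronglyMeasurable_quant hm hgm
  refine continuousAt_of_dominated
    (bound := fun η => C * (1 + ‖η‖) ^ (-(n + 1 : ℝ)) * SchwartzMap.seminorm ℝ 0 0 b) ?_ ?_
    ((integrable_decay.const_mul _).mul_const _) ?_
  · refine Filter.Eventually.of_forall fun t => ?_
    have h1 := hq.comp_measurable (measurable_prodMk_right (y := t) (α := Rn n))
    have h2 : AEStronglyMeasurable (fun η : Rn n => b (t⁻¹ • η)) :=
      Measurable.aestronglyMeasurable (by fun_prop)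
    exact h1.aestronglyMeasurable.mul h2
  · have h1 : ∀ᶠ t in nhds lam, |lam| / 2 < |t| :=
      continuous_abs.continuousAt.eventually_const_lt (by linarith)
    have h2 : ∀ᶠ t in nhds lam, |t| < 2 * |lam| :=
      continuous_abs.continuousAt.eventually_lt_const (by linarith)
    filter_upwards [h1, h2] with t h1 h2
    refine Filter.Eventually.of_forall fun η => ?_
    rw [norm_mul]
    exact mul_le_mul (hC η t h1.le h2.le) (norm_apply_le_of_schwartz b _) (norm_nonneg _)
      (by positivity)
  · refine Filter.Eventually.of_forall fun η => ?_
    have h3 : ContinuousAt (fun t : ℝ => b (t⁻¹ • η)) lam :=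
      b.continuous.continuousAt.comp ((continuousAt_inv₀ hl).smul continuousAt_const)
    exact (continuousAt_quant hf hm hM g.integrable hgm η hl).mul h3

/-- The identity `K φ = conj (K φ⋆)` for `φ (k) = F (k⁻¹)`, where the Fourier transform of `F` is a
left wave: then `φ` is the Fourier transform of a right wave, and `φ⋆ = conj F`. -/
theorem symmetry_leftWave {K : 𝓢'(Heis n, ℂ)} (hsymm : IsSymmetric K) {m : Heis n → ℂ}
    (hK : HasFlagMultiplier K m) (hm : Measurable m) {M : ℝ} (hM : ∀ ζ, ‖m ζ‖ ≤ M)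
    {χ : ℝ → ℝ} {δ R : ℝ} (hχ : IsCutoff χ δ R) (α g : 𝓢(Rn n, ℂ)) :
    ∫ t, χ t • ∫ η, quant m g (η, t) * (𝓕⁻ α) (t⁻¹ • η) =
      conj (∫ t, χ t • symbolForm m α (𝓕 g) t) := by
  obtain ⟨Φ, hΦ⟩ := exists_schwartz_leftWave α (𝓕 g) hχ
  have e1 := flag_apply_reflect hK hm hM hχ α g hΦ 0
  have e2 : ∫ z, quant m g z * waveCoeff χ (𝓕⁻ α) 0 z =
      ∫ t, χ t • ∫ η, quant m g (η, t) * (𝓕⁻ α) (t⁻¹ • η) := by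
    have hi := (integrable_waveCoeff hχ (𝓕⁻ α) 0).bdd_mul
      (stronglyMeasurable_quant hm g.continuous.measurable).aestronglyMeasurable
      (Filter.Eventually.of_forall fun z => norm_quant_le hM g.integrable z)
    rw [Measure.volume_eq_prod] at hi ⊢
    rw [integral_prod_symm _ hi]
    refine integral_congr_ae (Filter.Eventually.of_forall fun t => ?_)
    simp only []
    rw [← integral_smul]
    refine integral_congr_ae (Filter.Eventually.of_forall fun η => ?_)
    simp only [waveCoeff, xc_zero, yc_zero, tc_zero, inner_zero_left, zero_mul, add_zero,
      chi_zero, one_mul, zero_add, Complex.real_smul]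
    ring
  have e3 : K (involution (reflect 0 (𝓕⁻ Φ))) = ∫ ζ, m ζ * conj (Φ ζ) := by
    rw [apply_eq_integral_of_multiplier hK]
    refine integral_congr_ae (Filter.Eventually.of_forall fun ζ => ?_)
    simp only []
    congr 1
    have : Φ ζ = 𝓕 (𝓕⁻ Φ) ζ := by rw [FourierTransform.fourier_fourierInv_eq]
    rw [this, SchwartzMap.fourierInv_coe, fourierInv_eq_chi, SchwartzMap.fourier_coe,
      fourier_eq_chi, ← integral_conj]
    refine integral_congr_ae (Filter.Eventually.of_forall fun v => ?_)
    simp only [involution_reflect_zero, map_mul, conj_chi, neg_neg]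
  have e4 : ∫ ζ, m ζ * conj (Φ ζ) = ∫ t, χ t • symbolForm m α (𝓕 g) t := by
    have hi : Integrable fun ζ => m ζ * conj (Φ ζ) :=
      ((Complex.conjCLE : ℂ →L[ℝ] ℂ).integrable_comp Φ.integrable).bdd_mul
        hm.aestronglyMeasurable (Filter.Eventually.of_forall hM)
    rw [integrable_heis_iff] at hi
    have mp := volume_preserving_prodAssoc (α₁ := Rn n) (β₁ := Rn n) (γ₁ := ℝ)
    have hi2 := (mp.integrable_comp_emb MeasurableEquiv.prodAssoc.measurableEmbedding).2 hi
    rw [integral_heis, ← mp.integral_comp', Measure.volume_eq_prod]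
    rw [Measure.volume_eq_prod] at hi2
    refine (integral_prod_symm _ hi2).trans ?_
    refine integral_congr_ae (Filter.Eventually.of_forall fun t => ?_)
    simp only []
    rw [symbolForm, ← integral_smul]
    refine integral_congr_ae (Filter.Eventually.of_forall fun p => ?_)
    change m (mk p.1 p.2 t) * conj (Φ (mk p.1 p.2 t)) = _
    rw [hΦ]
    simp only [leftWave, xc_mk, yc_mk, tc_mk, map_mul, conj_chi, Complex.conj_ofReal,
      Complex.real_smul]
    ring
  rw [← e2, ← e1, hsymm, e3, e4]

/-- The symbol operators of a symmetric flag kernel are symmetric at every level `λ ≠ 0`. -/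
theorem quant_symmetric {K : 𝓢'(Heis n, ℂ)} (hsymm : IsSymmetric K) {m : Heis n → ℂ}
    (hK : HasFlagMultiplier K m) (hm : Measurable m) {M : ℝ} (hM : ∀ ζ, ‖m ζ‖ ≤ M)
    (g₁ g₂ : 𝓢(Rn n, ℂ)) {lam : ℝ} (hl : lam ≠ 0) :
    ∫ η, quant m g₁ (η, lam) * conj (𝓕 g₂ η) =
      conj (∫ η, quant m g₂ (η, lam) * conj (𝓕 g₁ η)) := by
  obtain ⟨f₁, hf₁⟩ := exists_schwartz_scale g₂ (inv_ne_zero hl)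
  obtain ⟨f₂, hf₂⟩ := exists_schwartz_conj f₁
  -- The left wave is adapted to the level `lam`: there `conj α` corresponds to `g₂`.
  let α : 𝓢(Rn n, ℂ) := (((|lam| ^ n)⁻¹ : ℝ) : ℂ) • f₂
  have hα : ∀ x, α x = (((|lam| ^ n)⁻¹ : ℝ) : ℂ) * conj (g₂ (lam⁻¹ • x)) := fun x => by
    change (((|lam| ^ n)⁻¹ : ℝ) : ℂ) • f₂ x = _
    rw [hf₂, hf₁, smul_eq_mul]
  have hβ : ∀ η, (𝓕⁻ α) (lam⁻¹ • η) = conj (𝓕 g₂ η) := fun η => by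
    rw [SchwartzMap.fourierInv_coe, fourierInv_eq_chi, SchwartzMap.fourier_coe, fourier_eq_chi,
      ← integral_conj,
      ← integral_inv_smul_scale (fun u => conj (chi (-inner ℝ u η) * g₂ u)) hl]
    refine integral_congr_ae (Filter.Eventually.of_forall fun x => ?_)
    simp only [hα, map_mul, conj_chi, neg_neg, inner_smul_left, inner_smul_right,
      RCLike.conj_to_real]
    ring
  have hS : symbolForm m α (𝓕 g₁) lam = ∫ η, quant m g₂ (η, lam) * conj (𝓕 g₁ η) := by
    have hi := integrable_symbolForm hm hM α (𝓕 g₁) lam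
    rw [Measure.volume_eq_prod] at hi
    rw [symbolForm, Measure.volume_eq_prod, integral_prod_symm _ hi]
    refine integral_congr_ae (Filter.Eventually.of_forall fun η => ?_)
    simp only []
    rw [quant, ← integral_mul_const, ← integral_inv_smul_scale
      (fun u => m (mk (lam • u) η lam) * chi (-inner ℝ u η) * g₂ u * conj (𝓕 g₁ η)) hl]
    refine integral_congr_ae (Filter.Eventually.of_forall fun x => ?_)
    simp only [hα, map_mul, Complex.conj_conj, Complex.conj_ofReal, smul_inv_smul₀ hl,
      inner_smul_left, RCLike.conj_to_real]
    ring
  have cL : ContinuousOn (fun t => ∫ η, quant m g₁ (η, t) * (𝓕⁻ α) (t⁻¹ • η)) {t | t ≠ 0} :=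
    fun t ht => (continuousAt_integral_quant_mul hK.1 hm hM g₁ _ ht).continuousWithinAt
  have cS : ContinuousOn (fun t => conj (symbolForm m α (𝓕 g₁) t)) {t | t ≠ 0} := fun t ht =>
    (Complex.continuous_conj.continuousAt.comp
      (continuousAt_symbolForm hK.1 hm hM α _ ht)).continuousWithinAt
  have h := eq_zero_of_cutoff (cL.sub cS) (fun χ δ R hχ => ?_) hl
  · simp only [Pi.sub_apply] at h
    rw [hS] at h
    simpa only [hβ] using sub_eq_zero.1 h
  · simp only [Pi.sub_apply, smul_sub]
    rw [integral_sub (hχ.integrable_smul cL) (hχ.integrable_smul cS),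
      symmetry_leftWave hsymm hK hm hM hχ, ← integral_conj, sub_eq_zero]
    refine integral_congr_ae (Filter.Eventually.of_forall fun t => ?_)
    simp

/-! ### The representation operators -/

/-- A symmetric operator that is bounded below is invertible. -/
theorem exists_equiv_of_symmetric {H : Type*} [NormedAddCommGroup H] [InnerProductSpace ℂ H]
    [CompleteSpace H] (B : H →L[ℂ] H) (hs : ∀ x y, inner ℂ (B x) y = inner ℂ x (B y)) {c : ℝ}
    (hc : 0 ≤ c) (hb : ∀ x, ‖x‖ ≤ c * ‖B x‖) :
    ∃ E : H ≃L[ℂ] H, (E : H →L[ℂ] H) = B ∧ ‖(E.symm : H →L[ℂ] H)‖ ≤ c := by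
  have hanti : AntilipschitzWith ⟨c, hc⟩ B := B.antilipschitz_of_bound fun x => hb x
  have hker : B.ker = ⊥ := LinearMap.ker_eq_bot.2 hanti.injective
  have hclosed : IsClosed (B.range : Set H) := by
    rw [LinearMap.coe_range]
    exact hanti.isClosed_range B.uniformContinuous
  have hrange : B.range = ⊤ := by
    have h1 : B.rangeᗮ = ⊥ := by
      rw [Submodule.eq_bot_iff]
      intro y hy
      have h2 : ∀ x, inner ℂ x (B y) = 0 := fun x => by
        rw [← hs]
        exact (Submodule.mem_orthogonal _ _).1 hy _ ⟨x, rfl⟩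
      have h3 : B y = 0 := inner_self_eq_zero.1 (h2 (B y))
      have := hb y
      rw [h3, norm_zero, mul_zero] at this
      exact norm_le_zero_iff.1 this
    rw [← hclosed.submodule_topologicalClosure_eq, Submodule.topologicalClosure_eq_top_iff]
    exact h1
  refine ⟨ContinuousLinearEquiv.ofBijective B hker hrange, rfl,
    ContinuousLinearMap.opNorm_le_bound _ hc fun y => ?_⟩
  refine (hb _).trans (le_of_eq ?_)
  congr 2
  exact ContinuousLinearEquiv.ofBijective_apply_symm_apply B hker hrange y

/-- The Schwartz function `u ↦ f̂(√|λ| u)`. -/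
def dilatedFourier (lam : ℝ) (hl : lam ≠ 0) : 𝓢(Rn n, ℂ) →ₗ[ℂ] 𝓢(Rn n, ℂ) :=
  (SchwartzMap.compCLMOfContinuousLinearEquiv ℂ
    (ContinuousLinearEquiv.smulLeft (R₁ := ℝ) (M₁ := Rn n)
      (Units.mk0 (√|lam|) (Real.sqrt_ne_zero'.2 (abs_pos.2 hl))))).toLinearMap ∘ₗ
    (SchwartzMap.fourierTransformCLM ℂ).toLinearMap

theorem dilatedFourier_apply {lam : ℝ} (hl : lam ≠ 0) (f : 𝓢(Rn n, ℂ)) (u : Rn n) :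
    dilatedFourier lam hl f u = 𝓕 f (√|lam| • u) := rfl

/-- The operator `π_K^λ` on Schwartz functions: the pseudodifferential operator
`f ↦ (s ↦ ∫ m (-σp, -√|λ| s, -λ) e^{2πi s p} f̂(p) dp)`, where `σ = sgn(λ) √|λ|`, written in
terms of `quant`. -/
def repFun (m : Heis n → ℂ) (lam : ℝ) (hl : lam ≠ 0) (f : 𝓢(Rn n, ℂ)) (s : Rn n) : ℂ :=
  ((√|lam| ^ n : ℝ) : ℂ) * quant m (dilatedFourier lam hl f) (-(√|lam| • s), -lam)

theorem repFun_eq (m : Heis n → ℂ) {lam : ℝ} (hl : lam ≠ 0) (f : 𝓢(Rn n, ℂ)) (s : Rn n) :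
    repFun m lam hl f s =
      ∫ p, m (mk (-((Real.sign lam * √|lam|) • p)) (-(√|lam| • s)) (-lam)) *
        (chi (inner ℝ s p) * 𝓕 f p) := by
  have hr : 0 < √|lam| := Real.sqrt_pos.2 (abs_pos.2 hl)
  have hlam : Real.sign lam * √|lam| * √|lam| = lam := by
    rw [mul_assoc, Real.mul_self_sqrt (abs_nonneg _)]
    rcases hl.lt_or_gt with h | h
    · rw [Real.sign_of_neg h, abs_of_neg h]; ring
    · rw [Real.sign_of_pos h, abs_of_pos h]; ring
  rw [repFun, quant, ← integral_inv_smul_scale (fun u => m (mk (-lam • u) (-(√|lam| • s)) (-lam)) *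
    chi (-inner ℝ u (-(√|lam| • s))) * dilatedFourier lam hl f u) hr.ne', ← integral_const_mul]
  refine integral_congr_ae (Filter.Eventually.of_forall fun p => ?_)
  have e1 : -lam • (√|lam|)⁻¹ • p = -((Real.sign lam * √|lam|) • p) := by
    rw [smul_smul, ← neg_smul]
    congr 1
    field_simp
    linarith
  simp only [dilatedFourier_apply, e1, smul_inv_smul₀ hr.ne', inner_neg_right, neg_neg,
    inner_smul_left, inner_smul_right, RCLike.conj_to_real, abs_of_pos hr]
  rw [mul_inv_cancel_left₀ hr.ne', real_inner_comm]
  have : ((√|lam| ^ n : ℝ) : ℂ) * (((√|lam| ^ n)⁻¹ : ℝ) : ℂ) = 1 := by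
    rw [← Complex.ofReal_mul, mul_inv_cancel₀ (by positivity), Complex.ofReal_one]
  rw [← mul_assoc, this]
  ring

theorem integrable_repFun {m : Heis n → ℂ} (hm : Measurable m) {M : ℝ} (hM : ∀ ζ, ‖m ζ‖ ≤ M)
    (lam : ℝ) (f : 𝓢(Rn n, ℂ)) (s : Rn n) :
    Integrable fun p => m (mk (-((Real.sign lam * √|lam|) • p)) (-(√|lam| • s)) (-lam)) *
        (chi (inner ℝ s p) * 𝓕 f p) :=
  ((𝓕 f).integrable.bdd_mul (c := 1) (by fun_prop)
    (Filter.Eventually.of_forall fun p => by simp)).bdd_mul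
    (Measurable.aestronglyMeasurable (by fun_prop)) (Filter.Eventually.of_forall fun p => hM _)

theorem integral_comp_neg_smul {E : Type*} [NormedAddCommGroup E] [NormedSpace ℝ E]
    (f : Rn n → E) {r : ℝ} (hr : 0 < r) :
    ∫ s, f (-(r • s)) = (r ^ n)⁻¹ • ∫ x, f x := by
  have h := Measure.integral_comp_smul volume f (-r)
  simp only [neg_smul] at h
  rw [h, finrank_euclideanSpace_fin, abs_inv, abs_pow, abs_neg, abs_of_pos hr]

theorem integral_repFun_sq (m : Heis n → ℂ) {lam : ℝ} (hl : lam ≠ 0) (f : 𝓢(Rn n, ℂ)) :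
    ∫ s, ‖repFun m lam hl f s‖ ^ 2 =
      √|lam| ^ n * ∫ η, ‖quant m (dilatedFourier lam hl f) (η, -lam)‖ ^ 2 := by
  have hr : 0 < √|lam| := Real.sqrt_pos.2 (abs_pos.2 hl)
  have h := integral_comp_neg_smul
    (fun η => ‖quant m (dilatedFourier lam hl f) (η, -lam)‖ ^ 2) hr
  simp only [repFun, norm_mul, mul_pow, Complex.norm_real, Real.norm_eq_abs, sq_abs]
  rw [integral_const_mul, h, smul_eq_mul]
  have : √|lam| ^ n ≠ 0 := by positivity
  field_simp

theorem integral_dilatedFourier_sq {lam : ℝ} (hl : lam ≠ 0) (f : 𝓢(Rn n, ℂ)) :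
    ∫ u, ‖dilatedFourier lam hl f u‖ ^ 2 = (√|lam| ^ n)⁻¹ * ∫ s, ‖f s‖ ^ 2 := by
  simp only [dilatedFourier_apply]
  rw [Measure.integral_comp_smul_of_nonneg volume (fun p => ‖𝓕 f p‖ ^ 2) _
    (hR := Real.sqrt_nonneg _), finrank_euclideanSpace_fin, smul_eq_mul,
    SchwartzMap.integral_norm_sq_fourier]

/-- Fourier inversion in the form in which `dilatedFourier` enters the operator `repFun`. -/
theorem fourier_dilatedFourier {lam : ℝ} (hl : lam ≠ 0) (f : 𝓢(Rn n, ℂ)) (s : Rn n) :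
    𝓕 (dilatedFourier lam hl f) (-(√|lam| • s)) = (((√|lam| ^ n)⁻¹ : ℝ) : ℂ) * f s := by
  have hr : 0 < √|lam| := Real.sqrt_pos.2 (abs_pos.2 hl)
  have h1 : f s = 𝓕⁻ (𝓕 f) s := by rw [FourierTransform.fourierInv_fourier_eq]
  have h2 := Measure.integral_comp_smul_of_nonneg volume (fun p => chi (inner ℝ p s) * 𝓕 f p) _
      (hR := hr.le)
  rw [finrank_euclideanSpace_fin] at h2
  rw [h1, SchwartzMap.fourierInv_coe, fourierInv_eq_chi, SchwartzMap.fourier_coe, fourier_eq_chi,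
    ← Complex.real_smul, ← h2]
  refine integral_congr_ae (Filter.Eventually.of_forall fun u => ?_)
  simp only [dilatedFourier_apply, inner_neg_right, neg_neg, inner_smul_left, inner_smul_right,
    RCLike.conj_to_real]

theorem integral_repFun_conj (m : Heis n → ℂ) {lam : ℝ} (hl : lam ≠ 0) (f₁ f₂ : 𝓢(Rn n, ℂ)) :
    ∫ s, repFun m lam hl f₁ s * conj (f₂ s) = ((√|lam| ^ n : ℝ) : ℂ) *
      ∫ η, quant m (dilatedFourier lam hl f₁) (η, -lam) *
        conj (𝓕 (dilatedFourier lam hl f₂) η) := by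
  have hr : 0 < √|lam| := Real.sqrt_pos.2 (abs_pos.2 hl)
  have h := integral_comp_neg_smul (fun η => quant m (dilatedFourier lam hl f₁) (η, -lam) *
        conj (𝓕 (dilatedFourier lam hl f₂) η)) hr
  have h2 : √|lam| ^ n ≠ 0 := by positivity
  have h3 : ∫ η, quant m (dilatedFourier lam hl f₁) (η, -lam) *
        conj (𝓕 (dilatedFourier lam hl f₂) η) = (√|lam| ^ n) • ∫ s,
      quant m (dilatedFourier lam hl f₁) (-(√|lam| • s), -lam) *
        conj (𝓕 (dilatedFourier lam hl f₂) (-(√|lam| • s))) := by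
    rw [h, smul_smul, mul_inv_cancel₀ h2, one_smul]
  rw [h3, Complex.real_smul, ← integral_const_mul, ← integral_const_mul]
  refine integral_congr_ae (Filter.Eventually.of_forall fun s => ?_)
  simp only [fourier_dilatedFourier, repFun, map_mul, Complex.conj_ofReal]
  have h4 : ((√|lam| ^ n : ℝ) : ℂ) * (((√|lam| ^ n)⁻¹ : ℝ) : ℂ) = 1 := by
    rw [← Complex.ofReal_mul, mul_inv_cancel₀ h2, Complex.ofReal_one]
  linear_combination (-((√|lam| ^ n : ℝ) : ℂ) *
    quant m (dilatedFourier lam hl f₁) (-(√|lam| • s), -lam) * conj (f₂ s)) * h4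

theorem memLp_repFun {m : Heis n → ℂ} (hf : IsFlagMultiplier m) (hm : Measurable m)
    {lam : ℝ} (hl : lam ≠ 0) (f : 𝓢(Rn n, ℂ)) : MemLp (repFun m lam hl f) 2 := by
  have hl' : 0 < |-lam| := abs_pos.2 (neg_ne_zero.2 hl)
  obtain ⟨C, hC0, hC⟩ := exists_quant_decay hf (dilatedFourier lam hl f) hl' |-lam|
  set g := dilatedFourier lam hl f
  have hq := stronglyMeasurable_quant hm g.continuous.measurable
  have h1 : MemLp (fun η => quant m g (η, -lam)) 2 := by
    have hm1 := (hq.comp_measurable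
      (measurable_prodMk_right (y := -lam) (α := Rn n))).aestronglyMeasurable (μ := volume)
    refine (memLp_two_iff_integrable_sq_norm hm1).2 ?_
    refine ((integrable_decay (n := n)).const_mul (C ^ 2)).mono' (hm1.norm.pow 2)
      (Filter.Eventually.of_forall fun η => ?_)
    rw [norm_pow, norm_norm]
    exact (pow_le_pow_left₀ (norm_nonneg _) (hC η _ le_rfl le_rfl) 2).trans (decay_sq_le C η)
  have hr : 0 < √|lam| := Real.sqrt_pos.2 (abs_pos.2 hl)
  have hm2 : AEStronglyMeasurable (repFun m lam hl f) := by
    have h2 : Measurable fun s : Rn n => (-(√|lam| • s), -lam) := by fun_prop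
    exact (hq.comp_measurable h2).aestronglyMeasurable.const_mul _
  rw [memLp_two_iff_integrable_sq_norm hm2]
  rw [memLp_two_iff_integrable_sq_norm h1.aestronglyMeasurable] at h1
  have h3 := ((integrable_comp_smul_iff volume (fun η => ‖quant m g (η, -lam)‖ ^ 2)
    (neg_ne_zero.2 hr.ne')).2 h1).const_mul ((√|lam| ^ n) ^ 2)
  refine h3.congr (Filter.Eventually.of_forall fun s => ?_)
  simp [repFun, g, mul_pow, neg_smul, abs_of_pos hr]

/-- `repFun` as a linear map from Schwartz functions to `L²`. -/
def repLM {m : Heis n → ℂ} (hf : IsFlagMultiplier m) (hm : Measurable m) {M : ℝ}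
    (hM : ∀ ζ, ‖m ζ‖ ≤ M) {lam : ℝ} (hl : lam ≠ 0) : 𝓢(Rn n, ℂ) →ₗ[ℂ] L2Rn n where
  toFun f := (memLp_repFun hf hm hl f).toLp
  map_add' f₁ f₂ := by
    rw [← MemLp.toLp_add]
    congr 1
    funext s
    rw [Pi.add_apply, repFun_eq, repFun_eq, repFun_eq,
      ← integral_add (integrable_repFun hm hM lam f₁ s) (integrable_repFun hm hM lam f₂ s)]
    refine integral_congr_ae (Filter.Eventually.of_forall fun p => ?_)
    simp only [FourierTransform.fourier_add, add_apply]
    ring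
  map_smul' c f := by
    rw [RingHom.id_apply, ← MemLp.toLp_const_smul]
    congr 1
    funext s
    rw [Pi.smul_apply, repFun_eq, repFun_eq, ← integral_smul]
    refine integral_congr_ae (Filter.Eventually.of_forall fun p => ?_)
    simp only [FourierTransform.fourier_smul, smul_apply, smul_eq_mul]
    ring

/-- For every `λ ≠ 0` the operator with symbol given by the flag kernel extends to an invertible
operator on `L²(ℝⁿ)`, whose inverse is bounded by that of `Op(K)`. -/
theorem exists_rep_equiv {K : 𝓢'(Heis n, ℂ)} (hsymm : IsSymmetric K) {m : Heis n → ℂ}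
    (hK : HasFlagMultiplier K m) (hm : Measurable m) {M : ℝ} (hM : ∀ ζ, ‖m ζ‖ ≤ M)
    (A : L2Heis n ≃L[ℂ] L2Heis n) (hA : IsOp K (A : L2Heis n →L[ℂ] L2Heis n))
    {lam : ℝ} (hl : lam ≠ 0) :
    ∃ B : L2Rn n ≃L[ℂ] L2Rn n,
      (∀ f : 𝓢(Rn n, ℂ), (B (f.toLp 2 volume) : Rn n → ℂ) =ᵐ[volume] repFun m lam hl f) ∧
      ‖(B.symm : L2Rn n →L[ℂ] L2Rn n)‖ ≤ ‖(A.symm : L2Heis n →L[ℂ] L2Heis n)‖ := by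
  let T := repLM hK.1 hm hM hl
  -- The operator is defined on the dense subspace of Schwartz functions and extended by continuity.
  let e : 𝓢(Rn n, ℂ) →ₗ[ℂ] L2Rn n := (SchwartzMap.toLpCLM ℂ ℂ 2 volume).toLinearMap
  have he : ∀ f, e f = f.toLp 2 volume := fun _ => rfl
  have hdense : DenseRange e :=
    SchwartzMap.denseRange_toLpCLM (E := Rn n) (F := ℂ) (p := 2) (by simp) (μ := volume)
  have hT : ∀ f, ‖T f‖ ^ 2 =
      √|lam| ^ n * ∫ η, ‖quant m (dilatedFourier lam hl f) (η, -lam)‖ ^ 2 := fun f => by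
    rw [← integral_repFun_sq]
    exact norm_toLp_sq (memLp_repFun hK.1 hm hl f)
  have hr : 0 < √|lam| ^ n := pow_pos (Real.sqrt_pos.2 (abs_pos.2 hl)) n
  have hg : ∀ f : 𝓢(Rn n, ℂ), √|lam| ^ n * ∫ u, ‖dilatedFourier lam hl f u‖ ^ 2 = ‖e f‖ ^ 2 :=
    fun f => by
    rw [integral_dilatedFourier_sq, he, norm_schwartz_sq, ← mul_assoc, mul_inv_cancel₀ hr.ne',
      one_mul]
  have hup : ∀ f, ‖T f‖ ≤ ‖(A : L2Heis n →L[ℂ] L2Heis n)‖ * ‖e f‖ := fun f => by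
    refine le_of_sq_le_sq ?_ (by positivity)
    rw [hT, mul_pow, ← hg]
    have := (quant_bounds hK hm hM A hA (dilatedFourier lam hl f) (neg_ne_zero.2 hl)).1
    calc _ ≤ _ := mul_le_mul_of_nonneg_left this hr.le
      _ = _ := by ring
  have hlow : ∀ f, ‖e f‖ ≤ ‖(A.symm : L2Heis n →L[ℂ] L2Heis n)‖ * ‖T f‖ := fun f => by
    refine le_of_sq_le_sq ?_ (by positivity)
    rw [mul_pow, hT, ← hg]
    have := (quant_bounds hK hm hM A hA (dilatedFourier lam hl f) (neg_ne_zero.2 hl)).2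
    calc _ ≤ _ := mul_le_mul_of_nonneg_left this hr.le
      _ = _ := by ring
  have hinner : ∀ (f₁ f₂ : 𝓢(Rn n, ℂ)), inner ℂ (e f₂) (T f₁) =
      ∫ s, repFun m lam hl f₁ s * conj (f₂ s) := fun f₁ f₂ => by
    rw [L2.inner_def]
    refine integral_congr_ae ?_
    filter_upwards [(memLp_repFun hK.1 hm hl f₁).coeFn_toLp, f₂.coeFn_toLp 2 volume] with s h1 h2
    rw [he, h2]
    change inner ℂ (f₂ s) (((memLp_repFun hK.1 hm hl f₁).toLp (repFun m lam hl f₁) : Rn n → ℂ) s) = _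
    rw [h1]
    rfl
  have hsym : ∀ f₁ f₂, inner ℂ (T f₁) (e f₂) = inner ℂ (e f₁) (T f₂) := fun f₁ f₂ => by
    rw [← inner_conj_symm, hinner, hinner, integral_repFun_conj, integral_repFun_conj,
      quant_symmetric hsymm hK hm hM _ _ (neg_ne_zero.2 hl), map_mul, Complex.conj_conj,
      Complex.conj_ofReal]
  let B : L2Rn n →L[ℂ] L2Rn n := T.extendOfNorm e
  have hB : ∀ f, B (e f) = T f := T.extendOfNorm_eq hdense ⟨_, hup⟩
  have hBlow : ∀ x, ‖x‖ ≤ ‖(A.symm : L2Heis n →L[ℂ] L2Heis n)‖ * ‖B x‖ := fun x =>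
    hdense.induction_on (p := fun x => ‖x‖ ≤ ‖(A.symm : L2Heis n →L[ℂ] L2Heis n)‖ * ‖B x‖) x
      (isClosed_le (by fun_prop) (by fun_prop)) fun f => by rw [hB]; exact hlow f
  have hBsym : ∀ x y, inner ℂ (B x) y = inner ℂ x (B y) := fun x y =>
    hdense.induction_on₂ (p := fun x y => inner ℂ (B x) y = inner ℂ x (B y))
      (isClosed_eq (by fun_prop) (by fun_prop))
      (fun f₁ f₂ => by rw [hB, hB]; exact hsym f₁ f₂) x y
  obtain ⟨E, hE, hE2⟩ := exists_equiv_of_symmetric B hBsym (norm_nonneg _) hBlow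
  refine ⟨E, fun f => ?_, hE2⟩
  have h1 : E (f.toLp 2 volume) = T f := by
    rw [← he, ← hB, ← hE]
    rfl
  rw [h1]
  exact (memLp_repFun hK.1 hm hl f).coeFn_toLp

/-! ### The pairing with the coefficients -/

/-- The frequency `(σp, √|λ| s, λ)`, `σ = sgn(λ) √|λ|`, of the coefficients of the representation
`π^λ`. -/
def freq (lam : ℝ) (q : Rn n × Rn n) : Heis n :=
  mk ((Real.sign lam * √|lam|) • q.1) (√|lam| • q.2) lam

/-- The density `e^{2πi s p} f̂(p) g(s)` of the Fourier transform of the coefficient `C_{f,g}^λ` in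
the parameters `(p, s)`. -/
def coeffDensity (f g : 𝓢(Rn n, ℂ)) (q : Rn n × Rn n) : ℂ :=
  chi (inner ℝ q.2 q.1) * 𝓕 f q.1 * g q.2

theorem integrable_coeffDensity (f g : 𝓢(Rn n, ℂ)) : Integrable (coeffDensity f g) := by
  have h := ((𝓕 f).integrable.mul_prod g.integrable (μ := volume) (ν := volume)).bdd_mul (c := 1)
    (f := fun q : Rn n × Rn n => chi (inner ℝ q.2 q.1)) (by fun_prop)
    (Filter.Eventually.of_forall fun q => by simp)
  exact h.congr (Filter.Eventually.of_forall fun q => by simp only [coeffDensity]; ring)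

theorem measurable_coeffDensity (f g : 𝓢(Rn n, ℂ)) : Measurable (coeffDensity f g) := by
  have h1 := (𝓕 f).continuous.measurable
  have h2 := g.continuous.measurable
  unfold coeffDensity
  fun_prop

/-- The coefficient `C_{f,g}^λ` is the inverse Fourier transform of the image of `coeffDensity` under
`freq`. -/
theorem coefficient_eq (f g : 𝓢(Rn n, ℂ)) (lam : ℝ) (h : Heis n) :
    coefficient lam f g h = ∫ q, chi (inner ℝ h (freq lam q)) * coeffDensity f g q := by
  have hi : Integrable fun q => chi (inner ℝ h (freq lam q)) * coeffDensity f g q :=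
    (integrable_coeffDensity f g).bdd_mul (c := 1)
      (Measurable.aestronglyMeasurable (by unfold freq; fun_prop))
      (Filter.Eventually.of_forall fun q => by simp)
  rw [Measure.volume_eq_prod] at hi ⊢
  rw [integral_prod_symm _ hi, coefficient]
  refine integral_congr_ae (Filter.Eventually.of_forall fun s => ?_)
  have h1 : f (s + (Real.sign lam * √|lam|) • xc h) =
      ∫ p, chi (inner ℝ p (s + (Real.sign lam * √|lam|) • xc h)) * 𝓕 f p := by
    have h2 : 𝓕⁻ (𝓕 f) = f := FourierTransform.fourierInv_fourier_eq f
    rw [← fourierInv_eq_chi, ← SchwartzMap.fourierInv_coe, h2]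
  change chi (lam * tc h) * chi (√|lam| * inner ℝ (yc h) s) *
    f (s + (Real.sign lam * √|lam|) • xc h) * g s = _
  rw [h1, ← integral_const_mul, ← integral_mul_const]
  refine integral_congr_ae (Filter.Eventually.of_forall fun p => ?_)
  simp only [freq, coeffDensity, inner_eq_coord, xc_mk, yc_mk, tc_mk]
  rw [inner_add_right, inner_smul_right, inner_smul_right, inner_smul_right, chi_add, chi_add,
    chi_add, real_inner_comm s p, real_inner_comm p (xc h), mul_comm (tc h) lam]
  ring

/-- The pairing of a flag kernel with a coefficient is the bilinear form of `repFun`. -/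
theorem hasPairing_coefficient {K : 𝓢'(Heis n, ℂ)} {m : Heis n → ℂ}
    (hK : HasFlagMultiplier K m) (hm : Measurable m) {M : ℝ} (hM : ∀ ζ, ‖m ζ‖ ≤ M)
    {lam : ℝ} (hl : lam ≠ 0) (f g : 𝓢(Rn n, ℂ)) :
    HasPairing K (coefficient lam f g) (∫ s, repFun m lam hl f s * g s) := by
  have hr : √|lam| ≠ 0 := Real.sqrt_ne_zero'.2 (abs_pos.2 hl)
  have hσ : Real.sign lam * √|lam| ≠ 0 := mul_ne_zero (by simpa using hl) hr
  set U := coeffDensity f g with hU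
  have hUi : Integrable U := integrable_coeffDensity f g
  have hUm : Measurable U := measurable_coeffDensity f g
  have hΨ : Measurable (freq lam : Rn n × Rn n → Heis n) := by unfold freq; fun_prop
  let par : Heis n → Rn n × Rn n := fun ζ =>
    ((Real.sign lam * √|lam|)⁻¹ • xc ζ, (√|lam|)⁻¹ • yc ζ)
  have hpar : Measurable par := by
    have : Continuous par := by fun_prop
    exact this.measurable
  have hparΨ : ∀ q, par (freq lam q) = q := fun q => by
    simp only [par, freq, xc_mk, yc_mk, inv_smul_smul₀ hσ, inv_smul_smul₀ hr]
  -- The measure is the image of `|U|`, and its density is the phase of `U`.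
  let μ : Measure (Rn n × Rn n) := volume.withDensity fun q => (‖U q‖₊ : ENNReal)
  let ρ : Heis n → ℂ := fun ζ => U (par ζ) / (‖U (par ζ)‖ : ℂ)
  have hρ : Measurable ρ := by
    have h1 : Measurable fun ζ => U (par ζ) := hUm.comp hpar
    exact h1.div (Complex.measurable_ofReal.comp h1.norm)
  have : IsFiniteMeasure μ := isFiniteMeasure_withDensity hUi.2.ne
  have key : ∀ G : Heis n → ℂ, Measurable G →
      ∫ ζ, G ζ * ρ ζ ∂(μ.map (freq lam)) = ∫ q, G (freq lam q) * U q := fun G hG => by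
    have hGρ : Measurable fun ζ => G ζ * ρ ζ := hG.mul hρ
    rw [integral_map hΨ.aemeasurable hGρ.aestronglyMeasurable,
      integral_withDensity_eq_integral_smul hUm.nnnorm]
    refine integral_congr_ae (Filter.Eventually.of_forall fun q => ?_)
    simp only [ρ, hparΨ]
    change ((‖U q‖ : ℝ)) • (G (freq lam q) * (U q / (‖U q‖ : ℂ))) = _
    rw [Complex.real_smul]
    by_cases h0 : U q = 0
    · simp [h0]
    · have : (‖U q‖ : ℂ) ≠ 0 := by exact_mod_cast norm_ne_zero_iff.2 h0
      field_simp
  refine ⟨m, hK, μ.map (freq lam), ρ, inferInstance, ?_, ⟨|lam|, abs_pos.2 hl, ?_⟩, fun h => ?_, ?_⟩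
  · refine Integrable.of_bound hρ.aestronglyMeasurable 1 (Filter.Eventually.of_forall fun ζ => ?_)
    simp only [ρ, norm_div, Complex.norm_real, norm_norm]
    exact div_self_le_one _
  · have hs : MeasurableSet {ζ : Heis n | |tc ζ| < |lam|} :=
      (isOpen_lt (by fun_prop) continuous_const).measurableSet
    rw [Measure.map_apply hΨ hs]
    have : freq lam ⁻¹' {ζ : Heis n | |tc ζ| < |lam|} = (∅ : Set (Rn n × Rn n)) := by
      ext q; simp [freq]
    rw [this, measure_empty]
  · rw [coefficient_eq]
    exact (key (fun ζ => chi (inner ℝ h ζ)) (by fun_prop)).symm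
  · rw [key (fun ζ => m (-ζ)) (by fun_prop)]
    have hi : Integrable fun q => m (-freq lam q) * U q :=
      hUi.bdd_mul (Measurable.aestronglyMeasurable (by fun_prop))
        (Filter.Eventually.of_forall fun q => hM _)
    rw [Measure.volume_eq_prod] at hi ⊢
    rw [integral_prod_symm _ hi]
    refine integral_congr_ae (Filter.Eventually.of_forall fun s => ?_)
    simp only []
    rw [repFun_eq, ← integral_mul_const]
    refine integral_congr_ae (Filter.Eventually.of_forall fun p => ?_)
    have e : -freq lam (p, s) =
        mk (-((Real.sign lam * √|lam|) • p)) (-(√|lam| • s)) (-lam) :=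
      ext_coord rfl rfl rfl
    simp only [e, hU, coeffDensity]
    ring

end FlagKernel

end

theorem mainTheorem2 (n : ℕ) (K : 𝓢'(FlagKernel.Heis n, ℂ))
    (hK : FlagKernel.IsFlagKernel K) (hsymm : FlagKernel.IsSymmetric K)
    (A : FlagKernel.L2Heis n ≃L[ℂ] FlagKernel.L2Heis n)
    (hA : FlagKernel.IsOp K (A : FlagKernel.L2Heis n →L[ℂ] FlagKernel.L2Heis n)) :
    ∃ C : ℝ, ∀ lam : ℝ, lam ≠ 0 →
      ∃ B : FlagKernel.L2Rn n ≃L[ℂ] FlagKernel.L2Rn n,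
        FlagKernel.IsRepresentationOperator K lam
          (B : FlagKernel.L2Rn n →L[ℂ] FlagKernel.L2Rn n) ∧
        ‖(B.symm : FlagKernel.L2Rn n →L[ℂ] FlagKernel.L2Rn n)‖ ≤ C := by
  obtain ⟨m, M, hm, hmeas, hM⟩ := hK.exists_multiplier
  refine ⟨‖(A.symm : FlagKernel.L2Heis n →L[ℂ] FlagKernel.L2Heis n)‖, fun lam hl => ?_⟩
  obtain ⟨B, hB, hle⟩ := FlagKernel.exists_rep_equiv hsymm hm hmeas hM A hA hl
  refine ⟨B, fun f g => ?_, hle⟩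
  have h : ∫ s, (B (f.toLp 2 volume) : FlagKernel.Rn n → ℂ) s * g s =
      ∫ s, FlagKernel.repFun m lam hl f s * g s := by
    refine integral_congr_ae ?_
    filter_upwards [hB f] with s hs
    rw [hs]
  change FlagKernel.HasPairing K _ (∫ s, (B (f.toLp 2 volume) : FlagKernel.Rn n → ℂ) s * g s)
  rw [h]
  exact FlagKernel.hasPairing_coefficient hm hmeas hM hl f g
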